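/- **Setting.** A dataset $\mathcal S=\{(u,S_u)\}_{u\in V}$ consists of a finite set $V$ of users, each with a finite set $S_u\subseteq\Sigma$ of items from an arbitrary (possibly infinite) universe $\Sigma$. Two datasets are neighboring if one is obtained from the other by removing one user together with their set. A randomized algorithm $\mathcal M$ that outputs a set of items is $(\varepsilon,\delta)$-DP if $\Pr(\mathcal M(\mathcal S)\in\mathcal O)\le e^{\varepsilon}\Pr(\mathcal M(\mathcal S')\in\mathcal O)+\delta$ for all neighboring $\mathcal S,\mathcal S'$ (in either order) and all sets $\mathcal O$ of possible outputs. $\Phi$ is the standard Gaussian cdf. **UserWeights**$(A,b,b_{\min},b_{\max})$, for a finite item set $A$ of size $d$. Set $w(i)=\max\{b_{\min},b(i)\}/\sqrt d$ for the biased items ($i\in A$, $b(i)<1$); then, with $B$ the set of biased items, set $w(i)=\min\{b_{\max}/\sqrt d,\ \sqrt{(1-\sum_{j\in B}w(j)^2)/|A\setminus B|}\}$ for $i\in A\setminus B$. While $\sum_{i\in A}w(i)^2<1$: let $L=\{i\in A: w(i)<1/\sqrt d\}$ and multiply $w(i)$, for all $i\in L$, by $\min\left\{\frac{b_{\max}/\sqrt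 d}{\max_{i\in L}w(i)},\ \sqrt{1+\frac{1-\sum_{i\in A}w(i)^2}{\sum_{i\in L}w(i)^2}}\right\}$. Return $w$ (for $A=\emptyset$ nothing is done). **MAD**$(\mathcal S,\tau,d_{\max},b,b_{\min},b_{\max})$. Let $\alpha=b_{\min}-\frac1{2\sqrt{d_{\max}}}$, $I=\{u\in V:\lceil 1/b_{\min}^2\rceil\le|S_u|\le d_{\max}\}$, $w_{\mathrm{init}}(i)=\sum_{u\in I,\,i\in S_u}1/|S_u|$, $r(i)=\max\{0,(w_{\mathrm{init}}(i)-\tau)/w_{\mathrm{init}}(i)\}$ (and $r(i)=0$ if $w_{\mathrm{init}}(i)=0$), $w_{\mathrm{trunc}}(i)=\min\{w_{\mathrm{init}}(i),\tau\}$, $e_u=\frac1{|S_u|}\sum_{i\in S_u}r(i)$, $w_{\mathrm{reroute}}(i)=\sum_{u\in I,\,i\in S_u}\alpha e_u/d_{\max}$. With $w_b^u=\mathrm{UserWeights}(S_u,b,b_{\min},b_{\max})$, return $$w(i)=w_{\mathrm{trunc}}(i)+w_{\mathrm{reroute}}(i)+\sum_{u\in I,\,i\in S_u}\Big(w_b^u(i)-\tfrac1{|S_u|}\Big)+\sum_{u\in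 V\setminus I,\,i\in S_u}w_b^u(i).$$ **MAD2R.** Parameters: $\varepsilon_1,\varepsilon_2>0$, $\delta_1,\delta_2\in(0,1]$, an integer $\Delta_0\ge1$, reals $d_{\max}>1$, $\beta,C_{lb},C_{ub}\ge0$, $b_{\min}\in[\frac12,1]$, $b_{\max}\in[1,\infty)$. For $r\in\{1,2\}$ let $\sigma_r>0$ be any number satisfying the Gaussian mechanism condition for $(\varepsilon_r,\delta_r/2)$ and $\ell_2$ sensitivity $1$, $$\Phi\Big(\tfrac1{2\sigma_r}-\varepsilon_r\sigma_r\Big)-e^{\varepsilon_r}\,\Phi\Big(-\tfrac1{2\sigma_r}-\varepsilon_r\sigma_r\Big)\le\tfrac{\delta_r}2,$$ and let $\rho_r=\max_{1\le t\le\Delta_0}\Big(\frac{h_r}{\sqrt t}+\sigma_r\Phi^{-1}\big((1-\frac{\delta_r}2)^{1/t}\big)\Big)$ with $h_1=1$, $h_2=b_{\max}$. 1. For each user independently, replace $S_u$ by a uniformly random subset of $S_u$ of size $\min\{\Delta_0,|S_u|\}$. Let $\mathcal U=\bigcup_u S_u$. 2. (Round 1) Let $w_1=\mathrm{MAD}(\mathcal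 S,\rho_1+\beta\sigma_1,d_{\max},\vec 1,1,1)$ and $\tilde w_1(i)=w_1(i)+\mathcal N(0,\sigma_1^2)$, independently for $i\in\mathcal U$; let $U_1=\{i\in\mathcal U:\tilde w_1(i)\ge\rho_1\}$. 3. (Round 2) Let $\tilde w_{lb}=\max\{0,\tilde w_1-C_{lb}\sigma_1\}$, $\tilde w_{ub}=\tilde w_1+C_{ub}\sigma_1$, $U_{low}=\{i\in\mathcal U:\tilde w_{ub}(i)<\rho_2\}$. Replace each $S_u$ by $S_u\setminus(U_1\cup U_{low})$ and let $\mathcal U_2$ be the union of the resulting sets. Let $b(i)=\min\{1,\rho_2/\tilde w_{lb}(i)\}$ (equal to $1$ if $\tilde w_{lb}(i)=0$), let $w_2=\mathrm{MAD}(\mathcal S,\rho_2+\beta\sigma_2,d_{\max},b,b_{\min},b_{\max})$ on the new sets, and $\tilde w_2(i)=w_2(i)+\mathcal N(0,\sigma_2^2)$ with fresh independent noise; let $U_2=\{i\in\mathcal U_2:\tilde w_2(i)\ge\rho_2\}$. 4. Return $U_1\cup U_2$. **Theorem.** MAD2R is $(\varepsilon_1+\varepsilon_2,\ \delta_1+\delta_2)$-differentially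 private. -/

import Mathlib

open MeasureTheory ProbabilityTheory
open scoped ENNReal

namespace PartitionSelection

/-! ### Datasets, neighbours and differential privacy -/

/-- A dataset: a finite set of users, each user `u` owning a finite set `items u` of items of the
universe `ι`.  (The values of `items` outside `users` are irrelevant.) -/
structure Dataset (υ ι : Type*) where
  users : Finset υ
  items : υ → Finset ι

/-- `S'` is `S` together with one new user `v` and its item set. -/
def Dataset.AddsUser {υ ι : Type*} [DecidableEq υ] (S S' : Dataset υ ι) : Prop :=
  ∃ v, v ∉ S.users ∧ S'.users = insert v S.users ∧ ∀ u ∈ S.users, S'.items u = S.items u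

/-- Two datasets are neighbouring if one is obtained by removing a single user from the other. -/
def Dataset.Neighboring {υ ι : Type*} [DecidableEq υ] (S S' : Dataset υ ι) : Prop :=
  S.AddsUser S' ∨ S'.AddsUser S

/-- The union of all the user sets. -/
def Dataset.union {υ ι : Type*} [DecidableEq ι] (S : Dataset υ ι) : Finset ι :=
  S.users.biUnion S.items

/-- User-level `(ε, δ)`-differential privacy of a randomized algorithm which takes a dataset and
outputs a (finite) set of items.  The algorithm is given by its output probabilities:
`Pr S O` is the probability that its output on `S` lies in `O`. -/
def IsDP {υ ι : Type*} [DecidableEq υ] (Pr : Dataset υ ι → Set (Finset ι) → ℝ≥0∞)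
    (ε δ : ℝ) : Prop :=
  ∀ S S' : Dataset υ ι, S.Neighboring S' → ∀ O : Set (Finset ι),
    Pr S O ≤ ENNReal.ofReal (Real.exp ε) * Pr S' O + ENNReal.ofReal δ

/-! ### The Gaussian mechanism and the threshold -/

/-- The standard Gaussian cumulative distribution function `Φ`. -/
noncomputable def Phi (x : ℝ) : ℝ := cdf (gaussianReal 0 1) x

/-- The standard Gaussian quantile function; for `0 < p < 1` it is the inverse `Φ⁻¹ p`. -/
noncomputable def PhiInv (p : ℝ) : ℝ := sInf {x : ℝ | p ≤ Phi x}

/-- `σ` is an admissible standard deviation for the (analytic) Gaussian mechanism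
with `ℓ₂` sensitivity `Δ₂` and privacy parameters `(ε, δ)`. -/
def IsGaussianScale (Δ₂ ε δ σ : ℝ) : Prop :=
  0 < σ ∧
    Phi (Δ₂ / (2 * σ) - ε * σ / Δ₂) - Real.exp ε * Phi (-(Δ₂ / (2 * σ)) - ε * σ / Δ₂) ≤ δ

/-- The threshold `ρ = max_{1 ≤ t ≤ Δ₀} (h t + σ Φ⁻¹((1 - δ/2)^{1/t}))`. It is only used with
`Δ₀ ≥ 1`. -/
noncomputable def threshold (Δ₀ : ℕ) (h : ℕ → ℝ) (σ δ : ℝ) : ℝ :=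
  if hne : (Finset.Icc 1 Δ₀).Nonempty then
    (Finset.Icc 1 Δ₀).sup' hne
      (fun t : ℕ => h t + σ * PhiInv ((1 - δ / 2) ^ (1 / (t : ℝ))))
  else 0

/-! ### The subroutine `UserWeights` -/

open Classical in
/-- `while guard do body`, started in the state `s`.  (A run that never leaves the loop returns
`s`.) -/
noncomputable def whileLoop {α : Type*} (guard : α → Prop) (body : α → α) (s : α) : α :=
  if h : ∃ n, ¬ guard (body^[n] s) then body^[Nat.find h] s else s

section UserWeights

variable {ι : Type*} [DecidableEq ι]

/-- The weight of a biased item (one with `b i < 1`), respecting the minimum bias. -/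
noncomputable def biasedWeight (A : Finset ι) (b : ι → ℝ) (bmin : ℝ) (i : ι) : ℝ :=
  max bmin (b i) / √(A.card : ℝ)

/-- The weights of a user with item set `A` when the loop is entered: biased items get their biased
weight, the unbiased ones share the remaining `ℓ₂` budget, respecting the maximum bias. -/
noncomputable def userInit (A : Finset ι) (b : ι → ℝ) (bmin bmax : ℝ) : ι → ℝ := fun i =>
  if i ∈ A then
    if b i < 1 then biasedWeight A b bmin i
    else min (bmax / √(A.card : ℝ))
      (√((1 - ∑ j ∈ A with b j < 1, biasedWeight A b bmin j ^ 2)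
        / ((A.filter fun j => ¬ b j < 1).card : ℝ)))
  else 0

/-- The items of `A` whose current weight is below `1/√|A|`. -/
noncomputable def smallItems (A : Finset ι) (w : ι → ℝ) : Finset ι :=
  A.filter fun i => w i < 1 / √(A.card : ℝ)

/-- The factor by which the loop body scales the weights of the small items. -/
noncomputable def scaleFactor (A : Finset ι) (bmax : ℝ) (w : ι → ℝ) : ℝ :=
  min
    (bmax / √(A.card : ℝ) /
      (if h : (smallItems A w).Nonempty then (smallItems A w).sup' h w else 0))
    (√(1 + (1 - ∑ i ∈ A, w i ^ 2) / ∑ i ∈ smallItems A w, w i ^ 2))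

/-- The loop body: scale up the small weights. -/
noncomputable def userStep (A : Finset ι) (bmax : ℝ) (w : ι → ℝ) : ι → ℝ := fun i =>
  if i ∈ smallItems A w then scaleFactor A bmax w * w i else w i

/-- `UserWeights(A, b, b_min, b_max)`. -/
noncomputable def userWeights (A : Finset ι) (b : ι → ℝ) (bmin bmax : ℝ) : ι → ℝ :=
  whileLoop (fun w => ∑ i ∈ A, w i ^ 2 < 1) (userStep A bmax) (userInit A b bmin bmax)

end UserWeights

/-! ### The weighting algorithm `MAD` -/

section MAD

variable {υ ι : Type*} [DecidableEq υ] [DecidableEq ι]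

/-- The degree `|S_u|` of a user, as a real number. -/
def deg (S : Dataset υ ι) (u : υ) : ℝ := ((S.items u).card : ℝ)

/-- The users that participate in adaptive reweighting. -/
noncomputable def adaptiveUsers (S : Dataset υ ι) (dmax bmin : ℝ) : Finset υ :=
  S.users.filter fun u => ⌈1 / bmin ^ 2⌉₊ ≤ (S.items u).card ∧ deg S u ≤ dmax

/-- The initial weights: each adaptive user sends `1/|S_u|` to each of its items. -/
noncomputable def wInit (S : Dataset υ ι) (dmax bmin : ℝ) (i : ι) : ℝ :=
  ∑ u ∈ adaptiveUsers S dmax bmin with i ∈ S.items u, 1 / deg S u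

/-- The fraction of the initial weight of an item that exceeds the adaptive threshold `τ`
(`0` if there is no initial weight). -/
noncomputable def excessRatio (S : Dataset υ ι) (τ dmax bmin : ℝ) (i : ι) : ℝ :=
  max 0 ((wInit S dmax bmin i - τ) / wInit S dmax bmin i)

/-- The initial weights, truncated at `τ`. -/
noncomputable def wTrunc (S : Dataset υ ι) (τ dmax bmin : ℝ) (i : ι) : ℝ :=
  min (wInit S dmax bmin i) τ

/-- The excess weight that is returned to a user. -/
noncomputable def userExcess (S : Dataset υ ι) (τ dmax bmin : ℝ) (u : υ) : ℝ :=
  1 / deg S u * ∑ i ∈ S.items u, excessRatio S τ dmax bmin i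

/-- The reroute discount factor `α`. -/
noncomputable def discount (dmax bmin : ℝ) : ℝ := bmin - 1 / (2 * √dmax)

/-- The rerouted weights. -/
noncomputable def wReroute (S : Dataset υ ι) (τ dmax bmin : ℝ) (i : ι) : ℝ :=
  ∑ u ∈ adaptiveUsers S dmax bmin with i ∈ S.items u,
    discount dmax bmin * userExcess S τ dmax bmin u / dmax

/-- The weights returned by `MAD(S, τ, d_max, b, b_min, b_max)`. -/
noncomputable def mad (S : Dataset υ ι) (τ dmax : ℝ) (b : ι → ℝ) (bmin bmax : ℝ) (i : ι) : ℝ :=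
  wTrunc S τ dmax bmin i + wReroute S τ dmax bmin i
    + ∑ u ∈ adaptiveUsers S dmax bmin with i ∈ S.items u,
        (userWeights (S.items u) b bmin bmax i - 1 / deg S u)
    + ∑ u ∈ S.users \ adaptiveUsers S dmax bmin with i ∈ S.items u,
        userWeights (S.items u) b bmin bmax i

end MAD

/-! ### The two-round algorithm `MAD2R` -/

/-- The parameters of `MAD2R`, together with the noise scales `σ₁, σ₂` it selects. -/
structure Params where
  (ε₁ δ₁ ε₂ δ₂ : ℝ)
  /-- noise standard deviations of the two rounds -/
  (σ₁ σ₂ : ℝ)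
  /-- degree cap -/
  Δ₀ : ℕ
  /-- maximum adaptive degree -/
  dmax : ℝ
  /-- adaptive threshold excess parameter -/
  β : ℝ
  /-- lower and upper bound constants -/
  (Clb Cub : ℝ)
  /-- minimum and maximum bias -/
  (bmin bmax : ℝ)

namespace Params

variable {υ ι : Type*} [DecidableEq υ] [DecidableEq ι]

/-- The standing requirements on the input of `MAD2R`, and the requirement that `σ₁` and `σ₂`
are chosen according to the Gaussian mechanism for `(ε_r, δ_r / 2)` and `ℓ₂` sensitivity `1`. -/
structure Valid (P : Params) : Prop where
  ε₁_pos : 0 < P.ε₁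
  ε₂_pos : 0 < P.ε₂
  δ₁_pos : 0 < P.δ₁
  δ₁_le_one : P.δ₁ ≤ 1
  δ₂_pos : 0 < P.δ₂
  δ₂_le_one : P.δ₂ ≤ 1
  scale₁ : IsGaussianScale 1 P.ε₁ (P.δ₁ / 2) P.σ₁
  scale₂ : IsGaussianScale 1 P.ε₂ (P.δ₂ / 2) P.σ₂
  one_le_Δ₀ : 1 ≤ P.Δ₀
  one_lt_dmax : 1 < P.dmax
  β_nonneg : 0 ≤ P.β
  Clb_nonneg : 0 ≤ P.Clb
  Cub_nonneg : 0 ≤ P.Cub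
  half_le_bmin : 1 / 2 ≤ P.bmin
  bmin_le_one : P.bmin ≤ 1
  one_le_bmax : 1 ≤ P.bmax

/-- The threshold of round 1. -/
noncomputable def ρ₁ (P : Params) : ℝ := threshold P.Δ₀ (fun t => 1 / √(t : ℝ)) P.σ₁ P.δ₁

/-- The threshold of round 2. -/
noncomputable def ρ₂ (P : Params) : ℝ := threshold P.Δ₀ (fun t => P.bmax / √(t : ℝ)) P.σ₂ P.δ₂

/-- The noisy weights of round 1 on a capped dataset, with noise vector `z`. -/
noncomputable def noisy₁ (P : Params) (S : Dataset υ ι) (z : ι → ℝ) (i : ι) : ℝ :=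
  mad S (P.ρ₁ + P.β * P.σ₁) P.dmax (fun _ => 1) 1 1 i + z i

/-- The items found in round 1. -/
noncomputable def found₁ (P : Params) (S : Dataset υ ι) (z : ι → ℝ) : Finset ι :=
  S.union.filter fun i => P.ρ₁ ≤ P.noisy₁ S z i

/-- The lower bound on the weights computed from noisy weights `w`. -/
noncomputable def lowerBound (P : Params) (w : ι → ℝ) (i : ι) : ℝ := max 0 (w i - P.Clb * P.σ₁)

/-- The upper bound on the weights computed from noisy weights `w`. -/
noncomputable def upperBound (P : Params) (w : ι → ℝ) (i : ι) : ℝ := w i + P.Cub * P.σ₁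

/-- The items whose upper bound is below the threshold of round 2. -/
noncomputable def lowItems (P : Params) (S : Dataset υ ι) (z : ι → ℝ) : Finset ι :=
  S.union.filter fun i => P.upperBound (P.noisy₁ S z) i < P.ρ₂

/-- The dataset of round 2: the items found in round 1 and the low items are removed from every
user set. -/
noncomputable def remaining (P : Params) (S : Dataset υ ι) (z : ι → ℝ) : Dataset υ ι where
  users := S.users
  items := fun u => S.items u \ (P.found₁ S z ∪ P.lowItems S z)

/-- The biases `min {1, ρ₂ / w_lb}`, where `ρ₂ / 0` is read as `+∞`. -/
noncomputable def bias (P : Params) (w : ι → ℝ) (i : ι) : ℝ :=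
  if P.lowerBound w i = 0 then 1 else min 1 (P.ρ₂ / P.lowerBound w i)

/-- The noisy weights of round 2; `z₁`, `z₂` are the noise vectors of the two rounds. -/
noncomputable def noisy₂ (P : Params) (S : Dataset υ ι) (z₁ z₂ : ι → ℝ) (i : ι) : ℝ :=
  mad (P.remaining S z₁) (P.ρ₂ + P.β * P.σ₂) P.dmax (P.bias (P.noisy₁ S z₁)) P.bmin P.bmax i
    + z₂ i

/-- The items found in round 2 (among the remaining ones). -/
noncomputable def found₂ (P : Params) (S : Dataset υ ι) (z₁ z₂ : ι → ℝ) : Finset ι :=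
  (P.remaining S z₁).union.filter fun i => P.ρ₂ ≤ P.noisy₂ S z₁ z₂ i

/-- The output of `MAD2R` on a capped dataset, as a function of the two noise vectors. -/
noncomputable def output (P : Params) (S : Dataset υ ι) (z : (ι → ℝ) × (ι → ℝ)) : Finset ι :=
  P.found₁ S z.1 ∪ P.found₂ S z.1 z.2

end Params

/-- Independent centred Gaussian noise of standard deviation `σ` on every item of the universe.
(The algorithm only reads the finitely many coordinates of the items it has seen.) -/
noncomputable def gaussianNoise (ι : Type*) (σ : ℝ) : Measure (ι → ℝ) :=
  Measure.infinitePi fun _ => gaussianReal 0 (Real.toNNReal (σ ^ 2))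

section Cap

variable {υ ι : Type*} [DecidableEq υ]

/-- All the ways to choose, for every user, a subset of its items of size `min {Δ₀, |S_u|}`. -/
def cappings (Δ₀ : ℕ) (S : Dataset υ ι) : Finset ((u : υ) → u ∈ S.users → Finset ι) :=
  S.users.pi fun u => (S.items u).powersetCard (min Δ₀ (S.items u).card)

/-- The dataset `S` with the user sets replaced by the chosen subsets. -/
def Dataset.capped (S : Dataset υ ι) (c : (u : υ) → u ∈ S.users → Finset ι) : Dataset υ ι where
  users := S.users
  items := fun u => if h : u ∈ S.users then c u h else ∅

/-- The probability that the output of `MAD2R` on `S` lies in `O`: the user sets are capped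
independently and uniformly at random, that is, by a uniformly random element of the finite set
`cappings Δ₀ S`; the noise vectors of the two rounds are independent of it and of each other. -/
noncomputable def mad2rProb [DecidableEq ι] (P : Params) (S : Dataset υ ι)
    (O : Set (Finset ι)) : ℝ≥0∞ :=
  (∑ c ∈ cappings P.Δ₀ S,
      ((gaussianNoise ι P.σ₁).prod (gaussianNoise ι P.σ₂)) {z | P.output (S.capped c) z ∈ O})
    / ((cappings P.Δ₀ S).card : ℝ≥0∞)

end Cap

end PartitionSelection

namespace PartitionSelection

/-! ### The Gaussian mechanism -/

/-! Each round of the algorithm is a noisy threshold applied to `MAD` weights, and two facts about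
the weights make such a round private. Let a user `v` be added. First, on the old items the weight
vector moves by at most 1 in `ℓ₂` norm, whatever the biases (`sum_mad_insert_sub_sq_le`). Second,
the items owned by `v` alone number some `t ≤ Δ₀`, each of weight at most `bmax/√t`
(`mad_insert_le`). Translating the noise by the change of the old weights then aligns the two runs.
The translation costs `(ε, δ/2)` by the Gaussian mechanism, and the event that a new item passes the
threshold costs another `δ/2`, by the choice of `ρ`.

The norm bound is clear for a non-adaptive user, whose weights have norm at most 1. For an adaptive
user of degree `d`, let `D ∈ [0,1]` be the mass that truncation removes from its contribution. Its
direct contribution has squared norm at most `1 - (2 bmin/√d - 1/d) D`. By conservation of mass the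
total excess returned to users grows by exactly `D`, so the rerouted weight changes by a vector of
norm at most `q = αD/√dmax`. The discount `α` is such that the direct part has norm at most `1 - q`
(`one_sub_mul_le_sq`), and the triangle inequality gives 1.

For the composition, fix noise in round 1 for which no new item passes. After the translation both
runs find the same set and have identical noisy weights on all old items. Hence the datasets of
round 2 again differ by the user `v`, with equal biases on the old items, and round 2 is private for
each such noise value. Integrating over the noise of round 1 adds the parameters
(`lintegral_le_of_gaussian_shift`); integration requires the output to be measurable in both noise
vectors. Finally the random capping is coupled by giving the old users the same subsets on both
sides. -/

lemma gaussianReal_eq_withDensity_centered (s : ℝ) {v : NNReal} (hv : v ≠ 0) :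
    gaussianReal s v = (gaussianReal 0 v).withDensity
      fun y => ENNReal.ofReal (Real.exp ((s * y - s ^ 2 / 2) / v)) := by
  rw [gaussianReal_of_var_ne_zero s hv, gaussianReal_of_var_ne_zero 0 hv,
    ← withDensity_mul _ (measurable_gaussianPDF 0 v) (by fun_prop)]
  congr 1
  ext y
  have hv' : (v : ℝ) ≠ 0 := by exact_mod_cast hv
  simp only [Pi.mul_apply, gaussianPDF, gaussianPDFReal]
  rw [← ENNReal.ofReal_mul (by positivity), mul_assoc _ (Real.exp _), ← Real.exp_add]
  congr 3
  field_simp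
  ring

lemma gaussianReal_Ioi (m t : ℝ) {σ : ℝ} (hσ : 0 < σ) :
    gaussianReal m (σ ^ 2).toNNReal (Set.Ioi t) = ENNReal.ofReal (Phi ((m - t) / σ)) := by
  have h1 : gaussianReal m (σ ^ 2).toNNReal
      = (gaussianReal 0 1).map (fun x => m - σ * x) := by
    have : (fun x => m - σ * x) = (fun x => m - x) ∘ (fun x => σ * x) := rfl
    rw [this, ← Measure.map_map (by fun_prop) (by fun_prop), gaussianReal_map_const_mul,
      gaussianReal_map_const_sub]
    simp only [mul_zero, sub_zero, mul_one]
    congr 1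
    ext
    simp [Real.toNNReal_of_nonneg (sq_nonneg σ)]
  have h2 : (fun x => m - σ * x) ⁻¹' Set.Ioi t = Set.Iio ((m - t) / σ) := by
    ext x
    simp only [Set.mem_preimage, Set.mem_Ioi, Set.mem_Iio, lt_div_iff₀ hσ]
    constructor <;> intro h <;> linarith
  have := nullSingletonClass_gaussianReal (μ := 0) (one_ne_zero (α := NNReal))
  rw [h1, Measure.map_apply (by fun_prop) measurableSet_Ioi, h2, Phi, ofReal_cdf,
    measure_congr Iio_ae_eq_Iic]

/-- The integrand is the positive part of the density ratio of `N(1,σ²)` to `N(0,σ²)` minus `e^ε`.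
It lives on a half-line, where its integral is a difference of two Gaussian tails, which is the left
side of the analytic Gaussian condition. -/
lemma lintegral_likelihoodRatio_sub_le {σ ε δ : ℝ} (h : IsGaussianScale 1 ε δ σ) :
    ∫⁻ y, (ENNReal.ofReal (Real.exp ((y - 1 / 2) / (σ ^ 2).toNNReal))
      - ENNReal.ofReal (Real.exp ε)) ∂gaussianReal 0 (σ ^ 2).toNNReal ≤ ENNReal.ofReal δ := by
  obtain ⟨hσ, h⟩ := h
  have hv : (σ ^ 2).toNNReal ≠ 0 := by simp [hσ.ne']
  have hvr : ((σ ^ 2).toNNReal : ℝ) = σ ^ 2 := Real.coe_toNNReal _ (sq_nonneg _)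
  -- The point at which the density ratio equals `e^ε`.
  set t : ℝ := ε * σ ^ 2 + 1 / 2 with ht
  set Λ : ℝ → ℝ≥0∞ := fun y => ENNReal.ofReal (Real.exp ((y - 1 / 2) / (σ ^ 2).toNNReal)) with hΛ
  set K := ENNReal.ofReal (Real.exp ε)
  have hle : ∀ y, y ≤ t ↔ (y - 1 / 2) / (σ ^ 2).toNNReal ≤ ε := by
    intro y
    rw [hvr, div_le_iff₀ (by positivity), ht]
    constructor <;> intro h <;> linarith
  have hind : ∀ y, Λ y - K = (Set.Ioi t).indicator (fun y => Λ y - K) y := by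
    intro y
    by_cases hy : y ∈ Set.Ioi t
    · simp [hy]
    · rw [Set.indicator_of_notMem hy]
      apply tsub_eq_zero_of_le
      apply ENNReal.ofReal_le_ofReal
      rw [Real.exp_le_exp, ← hle]
      simpa using hy
  rw [lintegral_congr hind, lintegral_indicator measurableSet_Ioi, lintegral_sub measurable_const]
  · have e1 : ∫⁻ y in Set.Ioi t, Λ y ∂gaussianReal 0 (σ ^ 2).toNNReal
        = ENNReal.ofReal (Phi ((1 - t) / σ)) := by
      rw [← gaussianReal_Ioi 1 t hσ, gaussianReal_eq_withDensity_centered 1 hv,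
        withDensity_apply _ measurableSet_Ioi]
      simp [hΛ]
    rw [e1, setLIntegral_const, gaussianReal_Ioi 0 t hσ,
      ← ENNReal.ofReal_mul (Real.exp_nonneg _), ← ENNReal.ofReal_sub]
    · apply ENNReal.ofReal_le_ofReal
      convert h using 3
      · rw [ht]
        field_simp
        ring
      · congr 1
        rw [ht]
        field_simp
        ring
    · exact mul_nonneg (Real.exp_nonneg _) (cdf_nonneg _ _)
  · rw [setLIntegral_const]
    exact ENNReal.mul_ne_top ENNReal.ofReal_ne_top (measure_ne_top _ _)
  · rw [Filter.EventuallyLE, ae_restrict_iff' measurableSet_Ioi]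
    refine Filter.Eventually.of_forall fun y hy => ?_
    apply ENNReal.ofReal_le_ofReal
    rw [Real.exp_le_exp]
    by_contra hc
    exact absurd ((hle y).2 (le_of_not_ge hc)) (not_le.2 hy)

/-! ### Translations of Gaussian noise on a product space. -/

section Noise

variable {ι : Type*}

instance (σ : ℝ) : IsProbabilityMeasure (gaussianNoise ι σ) := by
  unfold gaussianNoise; infer_instance

/-- The Cameron–Martin formula for a finitely supported translation. The translated measure and the
measure with the product density are both the product of the `gaussianReal (s i)`; for the latter it
suffices to check finite-dimensional boxes. -/
lemma lintegral_gaussianNoise_add [DecidableEq ι] {σ : ℝ} (hσ : σ ≠ 0) (F : Finset ι) (s : ι → ℝ)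
    (hs : ∀ i, i ∉ F → s i = 0) {g : (ι → ℝ) → ℝ≥0∞} (hg : Measurable g) :
    ∫⁻ z, g (z + s) ∂gaussianNoise ι σ
      = ∫⁻ z, (∏ i ∈ F, ENNReal.ofReal
          (Real.exp ((s i * z i - s i ^ 2 / 2) / (σ ^ 2).toNNReal))) * g z
          ∂gaussianNoise ι σ := by
  have hv : (σ ^ 2).toNNReal ≠ 0 := by simp [hσ]
  set v := (σ ^ 2).toNNReal
  have hmL : ∀ i, Measurable fun y : ℝ => ENNReal.ofReal
      (Real.exp ((s i * y - s i ^ 2 / 2) / v)) := fun i => by fun_prop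
  have hm : Measurable fun z : ι → ℝ => ∏ i ∈ F, ENNReal.ofReal
          (Real.exp ((s i * z i - s i ^ 2 / 2) / v)) := by
    fun_prop
  have h1 : (gaussianNoise ι σ).map (fun z => z + s)
      = Measure.infinitePi fun i => gaussianReal (s i) v := by
    have := Measure.infinitePi_map_pi (fun _ : ι => gaussianReal 0 v)
      (f := fun i x => x + s i) (fun i => by fun_prop)
    simp_rw [gaussianReal_map_add_const, zero_add] at this
    exact this
  have h2 : (gaussianNoise ι σ).withDensity (fun z => ∏ i ∈ F, ENNReal.ofReal
          (Real.exp ((s i * z i - s i ^ 2 / 2) / v)))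
      = Measure.infinitePi fun i => gaussianReal (s i) v := by
    refine Measure.eq_infinitePi _ fun S t ht => ?_
    rw [withDensity_apply _ (.pi S.countable_toSet fun _ _ => ht _),
      ← lintegral_indicator (.pi S.countable_toSet fun _ _ => ht _)]
    -- Extending the box by the whole line outside `S` turns indicator and density into a single
    -- product over `S ∪ F`, to which independence applies.
    set B : ι → Set ℝ := fun i => if i ∈ S then t i else Set.univ with hB
    have hBm : ∀ i, MeasurableSet (B i) := fun i => by
      by_cases h : i ∈ S <;> simp [hB, h, ht i]
    set X : ι → ℝ → ℝ≥0∞ := fun i => (B i).indicator fun y => ENNReal.ofReal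
          (Real.exp ((s i * y - s i ^ 2 / 2) / v))
    have hX : ∀ i, Measurable (X i) := fun i => (hmL i).indicator (hBm i)
    have e : ∀ z : ι → ℝ, ((S : Set ι).pi t).indicator (fun z : ι → ℝ => ∏ i ∈ F, ENNReal.ofReal
          (Real.exp ((s i * z i - s i ^ 2 / 2) / v))) z = ∏ i ∈ S ∪ F, X i (z i) := by
      intro z
      by_cases hz : z ∈ (S : Set ι).pi t
      · rw [Set.indicator_of_mem hz]
        rw [Finset.prod_subset (Finset.subset_union_right (s₁ := S))]
        · refine Finset.prod_congr rfl fun i _ => ?_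
          have : z i ∈ B i := by
            by_cases h : i ∈ S
            · simpa [hB, h] using hz i h
            · simp [hB, h]
          simp [X, this]
        · intro i _ hi
          simp [hs i hi]
      · rw [Set.indicator_of_notMem hz]
        simp only [Set.mem_pi, not_forall] at hz
        obtain ⟨i, hi, hzi⟩ := hz
        have hi' : i ∈ S := hi
        refine (Finset.prod_eq_zero (Finset.mem_union_left _ hi') ?_).symm
        simp [X, hB, hi', hzi]
    simp_rw [e]
    have hind : iIndepFun (fun i (z : ι → ℝ) => X i (z i)) (gaussianNoise ι σ) :=
      iIndepFun_infinitePi hX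
    rw [lintegral_prod_eq_prod_lintegral_of_indepFun _ _ hind (fun i => by fun_prop)]
    have e2 : ∀ i, ∫⁻ z, X i (z i) ∂gaussianNoise ι σ = gaussianReal (s i) v (B i) := by
      intro i
      rw [← lintegral_map (hX i) (by fun_prop), gaussianNoise, Measure.infinitePi_map_eval,
        lintegral_indicator (hBm i), gaussianReal_eq_withDensity_centered (s i) hv,
        withDensity_apply _ (hBm i)]
    simp_rw [e2]
    rw [← Finset.prod_subset (Finset.subset_union_left (s₁ := S) (s₂ := F))]
    · exact Finset.prod_congr rfl fun i hi => by simp [hB, hi]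
    · intro i _ hi
      simp [hB, hi]
  rw [← lintegral_map hg (by fun_prop), h1, ← h2, lintegral_withDensity_eq_lintegral_mul _ hm hg]
  rfl

lemma gaussianNoise_map_sum [DecidableEq ι] (σ : ℝ) (F : Finset ι) (s : ι → ℝ) :
    (gaussianNoise ι σ).map (fun z => ∑ i ∈ F, s i * z i)
      = gaussianReal 0 ((∑ i ∈ F, s i ^ 2).toNNReal * (σ ^ 2).toNNReal) := by
  induction F using Finset.induction_on with
  | empty => simp [Measure.map_const]
  | insert i F hi ih =>
    have hind : iIndepFun (fun i (z : ι → ℝ) => s i * z i) (gaussianNoise ι σ) :=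
      iIndepFun_infinitePi (X := fun i y => s i * y) (fun i => by fun_prop)
    have h := (hind.indepFun_finsetSum_of_notMem (fun i => by fun_prop) hi).symm
    have h1 : (gaussianNoise ι σ).map (fun z => s i * z i)
        = gaussianReal 0 ((s i ^ 2).toNNReal * (σ ^ 2).toNNReal) := by
      have : (fun z : ι → ℝ => s i * z i) = (fun x => s i * x) ∘ (fun z => z i) := rfl
      rw [this, ← Measure.map_map (by fun_prop) (by fun_prop), gaussianNoise,
        Measure.infinitePi_map_eval, gaussianReal_map_const_mul, mul_zero]
      congr 2
      ext
      simp [Real.toNNReal_of_nonneg (sq_nonneg (s i))]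
    have h2 := gaussianReal_add_gaussianReal_of_indepFun h h1 (by
      convert ih using 2
      ext z
      simp)
    simp_rw [Finset.sum_insert hi]
    rw [Real.toNNReal_add (sq_nonneg _) (Finset.sum_nonneg fun _ _ => sq_nonneg _), add_mul]
    convert h2 using 2
    · ext z
      simp
    · simp

/-- The density of the translated noise depends on `z` only through `∑ s i * z i`, which has law
`N(0,σ²)` when `s` is a unit vector. This reduces the claim to one dimension, through the pointwise
bound `Λ g ≤ e^ε g + (Λ - e^ε)⁺` for `g ≤ 1`. -/
lemma gaussian_mechanism_of_sum_sq_eq_one [DecidableEq ι] {σ ε δ : ℝ}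
    (h : IsGaussianScale 1 ε δ σ) (F : Finset ι) (s : ι → ℝ) (hs : ∀ i, i ∉ F → s i = 0)
    (hs1 : ∑ i ∈ F, s i ^ 2 = 1) {g : (ι → ℝ) → ℝ≥0∞} (hg : Measurable g) (hg1 : ∀ z, g z ≤ 1) :
    ∫⁻ z, g (z + s) ∂gaussianNoise ι σ
      ≤ ENNReal.ofReal (Real.exp ε) * ∫⁻ z, g z ∂gaussianNoise ι σ + ENNReal.ofReal δ := by
  rw [lintegral_gaussianNoise_add h.1.ne' F s hs hg]
  set v := (σ ^ 2).toNNReal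
  set Λ : ℝ → ℝ≥0∞ := fun y => ENNReal.ofReal (Real.exp ((y - 1 / 2) / v)) with hΛ
  have hΛm : Measurable Λ := by fun_prop
  have e : ∀ z : ι → ℝ, ∏ i ∈ F, ENNReal.ofReal (Real.exp ((s i * z i - s i ^ 2 / 2) / v))
      = Λ (∑ i ∈ F, s i * z i) := by
    intro z
    rw [← ENNReal.ofReal_prod_of_nonneg (fun _ _ => Real.exp_nonneg _), ← Real.exp_sum,
      ← Finset.sum_div, Finset.sum_sub_distrib, ← Finset.sum_div, hs1]
  simp_rw [e]
  calc _ ≤ ∫⁻ z, (ENNReal.ofReal (Real.exp ε) * g z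
          + (Λ (∑ i ∈ F, s i * z i) - ENNReal.ofReal (Real.exp ε))) ∂gaussianNoise ι σ := by
        refine lintegral_mono fun z => ?_
        calc Λ (∑ i ∈ F, s i * z i) * g z
            ≤ (ENNReal.ofReal (Real.exp ε)
              + (Λ (∑ i ∈ F, s i * z i) - ENNReal.ofReal (Real.exp ε))) * g z := by
              gcongr
              exact le_add_tsub
          _ ≤ _ := by
              rw [add_mul]
              gcongr
              exact mul_le_of_le_one_right' (hg1 z)
    _ = ENNReal.ofReal (Real.exp ε) * ∫⁻ z, g z ∂gaussianNoise ι σ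
          + ∫⁻ y, (Λ y - ENNReal.ofReal (Real.exp ε)) ∂gaussianReal 0 v := by
        have hlaw := gaussianNoise_map_sum (ι := ι) σ F s
        rw [hs1, Real.toNNReal_one, one_mul] at hlaw
        rw [lintegral_add_left (by fun_prop), lintegral_const_mul _ hg, ← hlaw,
          lintegral_map (by fun_prop) (by fun_prop)]
    _ ≤ _ := by
        gcongr
        exact lintegral_likelihoodRatio_sub_le h

/-- The Gaussian mechanism: shifting the noise by a finitely supported vector of norm at most `1`
changes expectations of `[0, 1]`-valued functions as in `(ε, δ)`-differential privacy. -/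
lemma gaussian_mechanism [DecidableEq ι] {σ ε δ : ℝ}
    (h : IsGaussianScale 1 ε δ σ) (F : Finset ι) (s : ι → ℝ) (hs : ∀ i, i ∉ F → s i = 0)
    (hs1 : ∑ i ∈ F, s i ^ 2 ≤ 1) {g : (ι → ℝ) → ℝ≥0∞} (hg : Measurable g) (hg1 : ∀ z, g z ≤ 1) :
    ∫⁻ z, g (z + s) ∂gaussianNoise ι σ
      ≤ ENNReal.ofReal (Real.exp ε) * ∫⁻ z, g z ∂gaussianNoise ι σ + ENNReal.ofReal δ := by
  have hmap : gaussianNoise ι σ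
      = (gaussianNoise (Option ι) σ).map (fun z i => z (some i)) :=
    (Measure.map_infinitePi_infinitePi_of_inj (P := fun _ => gaussianReal 0 (σ ^ 2).toNNReal)
      (Option.some_injective ι)).symm
  rw [hmap, lintegral_map (by fun_prop) (by fun_prop), lintegral_map (by fun_prop) (by fun_prop)]
  -- A fictitious coordinate `none` carries the missing length, so that the unit vector case applies
  -- and no monotonicity in the sensitivity is needed.
  let s' : Option ι → ℝ := fun o => o.elim (√(1 - ∑ i ∈ F, s i ^ 2)) s
  refine gaussian_mechanism_of_sum_sq_eq_one h (Finset.insertNone F) s' ?_ ?_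
    (g := fun z => g fun i => z (some i)) (by fun_prop) (fun z => hg1 _)
  · rintro (_ | i) hi
    · simp at hi
    · exact hs i (by simpa using hi)
  · rw [Finset.sum_insertNone]
    simp only [s', Option.elim]
    rw [Real.sq_sqrt (by linarith)]
    ring

end Noise

/-! ### Adaptive composition with the Gaussian mechanism. -/

section Composition

variable {ι : Type*}

/-- Composition of a mechanism `f` of noisy data with the Gaussian mechanism, up to the failure of
an event `E`. -/
lemma lintegral_le_of_gaussian_shift [DecidableEq ι] {σ ε δ : ℝ} (h : IsGaussianScale 1 ε δ σ)
    (F : Finset ι) (s : ι → ℝ) (hs : ∀ i, i ∉ F → s i = 0) (hs1 : ∑ i ∈ F, s i ^ 2 ≤ 1)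
    {f f' : (ι → ℝ) → ℝ≥0∞} (hf : Measurable f) (hf' : ∀ z, f' z ≤ 1)
    {E : Set (ι → ℝ)} (hEm : MeasurableSet E) (hE : gaussianNoise ι σ Eᶜ ≤ ENNReal.ofReal δ)
    {K D : ℝ≥0∞} (hff' : ∀ z ∈ E, f' z ≤ K * f (z + s) + D) :
    ∫⁻ z, f' z ∂gaussianNoise ι σ ≤ ENNReal.ofReal (Real.exp ε) * K * ∫⁻ z, f z ∂gaussianNoise ι σ
      + (D + (ENNReal.ofReal δ + ENNReal.ofReal δ)) := by
  -- Truncating at 1 before the Gaussian mechanism is applied keeps its `δ` from being multiplied by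
  -- `K`.
  let g : (ι → ℝ) → ℝ≥0∞ := fun z => min 1 (K * f z)
  have hg : Measurable g := measurable_const.min (hf.const_mul K)
  have hpt : ∀ z, f' z ≤ g (z + s) + (D + Eᶜ.indicator 1 z) := by
    intro z
    by_cases hz : z ∈ E
    · rcases le_total 1 (K * f (z + s)) with h1 | h1
      · refine (hf' z).trans ?_
        simp only [g, min_eq_left h1]
        exact le_self_add
      · simp only [g, min_eq_right h1]
        refine (hff' z hz).trans ?_
        gcongr
        exact le_self_add
    · refine (hf' z).trans ?_
      rw [Set.indicator_of_mem (by exact hz)]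
      exact le_add_left le_add_self
  calc ∫⁻ z, f' z ∂gaussianNoise ι σ
      ≤ ∫⁻ z, (g (z + s) + (D + Eᶜ.indicator 1 z)) ∂gaussianNoise ι σ := lintegral_mono hpt
    _ = ∫⁻ z, g (z + s) ∂gaussianNoise ι σ + (D + gaussianNoise ι σ Eᶜ) := by
        rw [lintegral_add_left (by fun_prop), lintegral_add_left (by fun_prop),
          lintegral_indicator_one hEm.compl]
        simp
    _ ≤ (ENNReal.ofReal (Real.exp ε) * ∫⁻ z, g z ∂gaussianNoise ι σ + ENNReal.ofReal δ)
          + (D + ENNReal.ofReal δ) := by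
        gcongr
        exact gaussian_mechanism h F s hs hs1 hg fun z => min_le_left _ _
    _ ≤ (ENNReal.ofReal (Real.exp ε) * (K * ∫⁻ z, f z ∂gaussianNoise ι σ) + ENNReal.ofReal δ)
          + (D + ENNReal.ofReal δ) := by
        rw [← lintegral_const_mul K hf]
        gcongr
        exact min_le_right _ _
    _ = _ := by ring

end Composition

/-! ### The threshold -/

lemma Phi_mono : Monotone Phi := monotone_cdf _

/-- If `x < 0`, the rays `(-∞, x]` and `[-x, ∞)` are disjoint and of mass at least 1/2 each, so the
gap between them is null; but a Gaussian charges every nonempty open interval. -/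
lemma nonneg_of_half_le_Phi {x : ℝ} (hx : 1 / 2 ≤ Phi x) : 0 ≤ x := by
  by_contra! hneg
  have hsymm : (gaussianReal 0 1).real (Set.Ici (-x)) = (gaussianReal 0 1).real (Set.Iic x) := by
    have := gaussianReal_map_neg (μ := 0) (v := 1)
    rw [neg_zero] at this
    conv_lhs => rw [← this]
    rw [map_measureReal_apply (by fun_prop) measurableSet_Ici]
    congr 1
    ext y
    simp
  have h1 : (1 / 2 : ℝ) ≤ (gaussianReal 0 1).real (Set.Iic x) := by
    rwa [Phi, cdf_eq_real] at hx
  have hdisj : Disjoint (Set.Iic x) (Set.Ici (-x)) := by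
    rw [Set.disjoint_left]
    intro y hy hy'
    simp only [Set.mem_Iic, Set.mem_Ici] at hy hy'
    linarith
  have hone : (gaussianReal 0 1).real (Set.Iic x ∪ Set.Ici (-x))ᶜ = 0 := by
    rw [probReal_compl_eq_one_sub (measurableSet_Iic.union measurableSet_Ici),
      measureReal_union hdisj measurableSet_Ici, hsymm]
    have := measureReal_le_one (μ := gaussianReal 0 1) (s := Set.Iic x ∪ Set.Ici (-x))
    rw [measureReal_union hdisj measurableSet_Ici, hsymm] at this
    linarith
  have hz : gaussianReal 0 1 (Set.Ioo x (-x)) = 0 := by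
    rw [measureReal_eq_zero_iff] at hone
    refine measure_mono_null ?_ hone
    intro y hy
    simp only [Set.mem_Ioo] at hy
    simp [hy.1, hy.2]
  have := gaussianReal_absolutelyContinuous' 0 (one_ne_zero (α := NNReal)) hz
  simp only [Real.volume_Ioo, ENNReal.ofReal_eq_zero] at this
  linarith

lemma PhiInv_nonneg {p : ℝ} (hp : 1 / 2 ≤ p) : 0 ≤ PhiInv p :=
  Real.sInf_nonneg fun _ hx => nonneg_of_half_le_Phi (hp.trans hx)

/-- By right continuity of the cdf the infimum defining the quantile satisfies the inequality; `p <
1` makes the set nonempty. -/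
lemma le_Phi_PhiInv {p : ℝ} (hp1 : p < 1) : p ≤ Phi (PhiInv p) := by
  have hne : {x : ℝ | p ≤ Phi x}.Nonempty :=
    (((tendsto_cdf_atTop (gaussianReal 0 1)).eventually (lt_mem_nhds hp1)).mono
      fun _ h => le_of_lt h).exists
  have hev : ∀ᶠ x in nhdsWithin (PhiInv p) (Set.Ioi (PhiInv p)), p ≤ Phi x := by
    refine eventually_nhdsWithin_of_forall fun x hx => ?_
    obtain ⟨y, hy, hyx⟩ := exists_lt_of_csInf_lt hne hx
    exact le_trans hy (Phi_mono hyx.le)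
  have hc : Filter.Tendsto Phi (nhdsWithin (PhiInv p) (Set.Ioi (PhiInv p)))
      (nhds (Phi (PhiInv p))) :=
    ((cdf (gaussianReal 0 1)).right_continuous (PhiInv p)).mono_left
      (nhdsWithin_mono _ Set.Ioi_subset_Ici_self)
  exact ge_of_tendsto hc hev

lemma le_threshold {Δ₀ t : ℕ} (ht : 1 ≤ t) (htΔ : t ≤ Δ₀) (h : ℕ → ℝ) (σ δ : ℝ) :
    h t + σ * PhiInv ((1 - δ / 2) ^ (1 / (t : ℝ))) ≤ threshold Δ₀ h σ δ := by
  have hmem : t ∈ Finset.Icc 1 Δ₀ := Finset.mem_Icc.2 ⟨ht, htΔ⟩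
  rw [threshold, dif_pos ⟨t, hmem⟩]
  exact Finset.le_sup' (fun t : ℕ => h t + σ * PhiInv ((1 - δ / 2) ^ (1 / (t : ℝ)))) hmem

/-- Take `t = 1`: as `δ ≤ 1`, the quantile at `1 - δ/2 ≥ 1/2` is nonnegative. This keeps the
truncation level of `MAD` at least 1. -/
lemma le_threshold_one {Δ₀ : ℕ} (hΔ : 1 ≤ Δ₀) (h : ℕ → ℝ) {σ δ : ℝ} (hσ : 0 ≤ σ) (hδ : δ ≤ 1) :
    h 1 ≤ threshold Δ₀ h σ δ := by
  refine le_trans ?_ (le_threshold le_rfl hΔ h σ δ)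
  simp only [Nat.cast_one, div_one, Real.rpow_one, le_add_iff_nonneg_right]
  exact mul_nonneg hσ (PhiInv_nonneg (by linarith))

lemma gaussianReal_Iio (a : ℝ) {σ : ℝ} (hσ : 0 < σ) :
    gaussianReal 0 (σ ^ 2).toNNReal (Set.Iio a) = ENNReal.ofReal (Phi (a / σ)) := by
  have h := gaussianReal_Ioi 0 (-a) hσ
  rw [zero_sub, neg_neg] at h
  rw [← h]
  have := gaussianReal_map_neg (μ := 0) (v := (σ ^ 2).toNNReal)
  rw [neg_zero] at this
  conv_rhs => rw [← this]
  rw [Measure.map_apply (by fun_prop) measurableSet_Ioi]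
  congr 1
  ext y
  simp

/-- The noise pushes one of `t ≤ Δ₀` weights that are at most `h t` above the threshold with
probability at most `δ / 2`. -/
lemma gaussianNoise_exists_threshold_le {ι : Type*} {Δ₀ : ℕ} {h : ℕ → ℝ} {σ δ : ℝ} (hσ : 0 < σ)
    (hδ0 : 0 < δ) (hδ1 : δ ≤ 1) (N : Finset ι) (hN : N.card ≤ Δ₀) (w : ι → ℝ)
    (hw : ∀ i ∈ N, w i ≤ h N.card) :
    gaussianNoise ι σ {z | ∀ i ∈ N, w i + z i < threshold Δ₀ h σ δ}ᶜ
      ≤ ENNReal.ofReal (δ / 2) := by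
  set ρ := threshold Δ₀ h σ δ
  have hset : {z : ι → ℝ | ∀ i ∈ N, w i + z i < ρ}
      = (N : Set ι).pi fun i => Set.Iio (ρ - w i) := by
    ext z
    simp only [Set.mem_ofPred_eq, Set.mem_pi, Finset.mem_coe, Set.mem_Iio, lt_sub_iff_add_lt']
  have hm : MeasurableSet {z : ι → ℝ | ∀ i ∈ N, w i + z i < ρ} := by
    rw [hset]
    exact .pi N.countable_toSet fun _ _ => measurableSet_Iio
  rw [prob_compl_eq_one_sub hm, tsub_le_iff_left, hset]
  have hpi : gaussianNoise ι σ ((N : Set ι).pi fun i => Set.Iio (ρ - w i))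
      = ∏ i ∈ N, gaussianReal 0 (σ ^ 2).toNNReal (Set.Iio (ρ - w i)) :=
    Measure.infinitePi_pi _ fun _ _ => measurableSet_Iio
  rw [hpi]
  rcases N.eq_empty_or_nonempty with rfl | hne
  · simp
  have ht : 1 ≤ N.card := hne.card_pos
  have ht' : (0 : ℝ) < N.card := by exact_mod_cast ht
  -- Each item stays below the threshold with probability at least `p`; by independence all of them
  -- do with probability at least `p ^ N.card = 1 - δ/2`.
  set p : ℝ := (1 - δ / 2) ^ (1 / (N.card : ℝ)) with hp
  have hp0 : 0 < p := Real.rpow_pos_of_pos (by linarith) _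
  have hp1 : p < 1 := Real.rpow_lt_one (by linarith) (by linarith) (by positivity)
  have hfac : ∀ i ∈ N, ENNReal.ofReal p ≤ gaussianReal 0 (σ ^ 2).toNNReal (Set.Iio (ρ - w i)) := by
    intro i hi
    rw [gaussianReal_Iio _ hσ]
    refine ENNReal.ofReal_le_ofReal ((le_Phi_PhiInv hp1).trans (Phi_mono ?_))
    rw [le_div_iff₀ hσ]
    have := le_threshold ht hN h σ δ
    have := hw i hi
    simp only [ρ, p]
    linarith
  have hpow : ENNReal.ofReal p ^ N.card = ENNReal.ofReal (1 - δ / 2) := by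
    rw [← ENNReal.ofReal_pow hp0.le, hp, ← Real.rpow_natCast, ← Real.rpow_mul (by linarith),
      one_div_mul_cancel ht'.ne', Real.rpow_one]
  calc (1 : ℝ≥0∞) = ENNReal.ofReal (1 - δ / 2) + ENNReal.ofReal (δ / 2) := by
        rw [← ENNReal.ofReal_add (by linarith) (by linarith)]
        simp
    _ ≤ _ := by
        gcongr
        rw [← hpow, ← Finset.prod_const]
        exact Finset.prod_le_prod' hfac

/-! ### `UserWeights` -/

/-- No termination proof is needed: a run that never stops returns the initial state, where the
invariant holds too. -/
lemma whileLoop_induction {α : Type*} {guard : α → Prop} {body : α → α} {Q : α → Prop} {s : α}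
    (h0 : Q s) (hstep : ∀ x, guard x → Q x → Q (body x)) : Q (whileLoop guard body s) := by
  classical
  rw [whileLoop]
  split_ifs with h
  · have key : ∀ n, n ≤ Nat.find h → Q (body^[n] s) := by
      intro n
      induction n with
      | zero => exact fun _ => h0
      | succ n ih =>
        intro hn
        rw [Function.iterate_succ_apply']
        exact hstep _ (not_not.1 (Nat.find_min h (Nat.lt_of_succ_le hn))) (ih (by omega))
    exact key _ le_rfl
  · exact h0

section UserWeights

variable {ι : Type*} [DecidableEq ι]

/-- The bounds that the weights assigned by a user satisfy throughout `UserWeights`. -/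
structure IsBoundedWeight (A : Finset ι) (bmin bmax : ℝ) (w : ι → ℝ) : Prop where
  lower : ∀ i ∈ A, bmin / √(A.card : ℝ) ≤ w i
  upper : ∀ i ∈ A, w i ≤ bmax / √(A.card : ℝ)
  sum_sq : ∑ i ∈ A, w i ^ 2 ≤ 1

/-- A biased item uses at most `1/|A|` of the squared budget, so the equal shares of the unbiased
items are at least `1/|A|`; this gives the lower bound for them. -/
lemma isBoundedWeight_userInit (A : Finset ι) (b : ι → ℝ) {bmin bmax : ℝ} (h0 : 0 ≤ bmin)
    (h1 : bmin ≤ 1) (h2 : 1 ≤ bmax) : IsBoundedWeight A bmin bmax (userInit A b bmin bmax) := by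
  rcases A.eq_empty_or_nonempty with rfl | hne
  · constructor <;> simp
  have hd : (0 : ℝ) < A.card := by exact_mod_cast hne.card_pos
  have hsd : 0 < √(A.card : ℝ) := Real.sqrt_pos.2 hd
  set B := A.filter fun j => b j < 1 with hB
  set C := A.filter fun j => ¬ b j < 1 with hC
  have hcard : (B.card : ℝ) + C.card = A.card := by
    exact_mod_cast Finset.card_filter_add_card_filter_not (s := A) (fun j => b j < 1)
  have hbl : ∀ i ∈ B, biasedWeight A b bmin i ≤ 1 / √(A.card : ℝ) := by
    intro i hi
    exact div_le_div_of_nonneg_right (max_le h1 (Finset.mem_filter.1 hi).2.le) hsd.le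
  have hb0 : ∀ i, 0 ≤ biasedWeight A b bmin i :=
    fun i => div_nonneg (h0.trans (le_max_left _ _)) hsd.le
  have hsumB : ∑ j ∈ B, biasedWeight A b bmin j ^ 2 ≤ B.card / A.card := by
    calc ∑ j ∈ B, biasedWeight A b bmin j ^ 2 ≤ ∑ j ∈ B, (1 / √(A.card : ℝ)) ^ 2 :=
          Finset.sum_le_sum fun i hi => pow_le_pow_left₀ (hb0 i) (hbl i hi) 2
      _ = B.card / A.card := by
          rw [Finset.sum_const, nsmul_eq_mul, div_pow, one_pow, Real.sq_sqrt hd.le]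
          ring
  set sB := ∑ j ∈ B, biasedWeight A b bmin j ^ 2
  have hBA : (B.card : ℝ) / A.card ≤ 1 := by
    rw [div_le_one hd]
    have : (0 : ℝ) ≤ C.card := by positivity
    linarith
  have hsB : 0 ≤ 1 - sB := by linarith
  refine ⟨fun i hi => ?_, fun i hi => ?_, ?_⟩
  · simp only [userInit, hi, if_true]
    split_ifs with hbi
    · exact div_le_div_of_nonneg_right (le_max_left _ _) hsd.le
    · have hiC : i ∈ C := Finset.mem_filter.2 ⟨hi, hbi⟩
      have hCpos : (0 : ℝ) < C.card := by exact_mod_cast Finset.card_pos.2 ⟨i, hiC⟩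
      refine le_min (div_le_div_of_nonneg_right (h1.trans h2) hsd.le) ?_
      calc bmin / √(A.card : ℝ) ≤ 1 / √(A.card : ℝ) := div_le_div_of_nonneg_right h1 hsd.le
        _ = √(1 / A.card) := by rw [Real.sqrt_div zero_le_one, Real.sqrt_one]
        _ ≤ _ := by
          apply Real.sqrt_le_sqrt
          rw [div_le_div_iff₀ hd hCpos]
          have : sB * A.card ≤ B.card := by rwa [le_div_iff₀ hd] at hsumB
          nlinarith
  · simp only [userInit, hi, if_true]
    split_ifs with hbi
    · exact (hbl i (Finset.mem_filter.2 ⟨hi, hbi⟩)).trans (div_le_div_of_nonneg_right h2 hsd.le)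
    · exact min_le_left _ _
  · rw [← Finset.sum_filter_add_sum_filter_not A (fun j => b j < 1)]
    have e1 : ∑ i ∈ B, userInit A b bmin bmax i ^ 2 = sB := by
      refine Finset.sum_congr rfl fun i hi => ?_
      obtain ⟨hiA, hbi⟩ := Finset.mem_filter.1 hi
      simp [userInit, hiA, hbi]
    have e2 : ∑ i ∈ C, userInit A b bmin bmax i ^ 2 ≤ ∑ i ∈ C, (1 - sB) / C.card := by
      refine Finset.sum_le_sum fun i hi => ?_
      obtain ⟨hiA, hbi⟩ := Finset.mem_filter.1 hi
      simp only [userInit, hiA, hbi, if_true, if_false]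
      calc _ ≤ √((1 - sB) / C.card) ^ 2 := by
            refine pow_le_pow_left₀ (le_min ?_ (Real.sqrt_nonneg _)) (min_le_right _ _) 2
            exact div_nonneg (by linarith) hsd.le
        _ = _ := Real.sq_sqrt (div_nonneg hsB (Nat.cast_nonneg _))
    have e3 : ∑ i ∈ C, (1 - sB) / C.card ≤ 1 - sB := by
      rw [Finset.sum_const, nsmul_eq_mul]
      rcases eq_or_ne (C.card : ℝ) 0 with h | h
      · simpa [h] using hsB
      · exact (mul_div_cancel₀ _ h).le
    linarith

/-- The guard makes the scale factor at least 1, which preserves the lower bound. The first term of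
its minimum caps the largest small weight at `bmax/√|A|`; the second is the factor that would bring
the sum of squares to exactly 1. -/
lemma IsBoundedWeight.userStep {A : Finset ι} {bmin bmax : ℝ} (h0 : 0 < bmin) (h2 : 1 ≤ bmax)
    {w : ι → ℝ} (hw : IsBoundedWeight A bmin bmax w) (hlt : ∑ i ∈ A, w i ^ 2 < 1) :
    IsBoundedWeight A bmin bmax (userStep A bmax w) := by
  set L := smallItems A w with hL
  by_cases hne : L.Nonempty
  swap
  · have : PartitionSelection.userStep A bmax w = w := by
      ext i
      rw [PartitionSelection.userStep, ← hL, Finset.not_nonempty_iff_eq_empty.1 hne]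
      simp
    rwa [this]
  have hLA : L ⊆ A := Finset.filter_subset _ _
  have hd : (0 : ℝ) < A.card := by exact_mod_cast (hne.mono hLA).card_pos
  have hsd : 0 < √(A.card : ℝ) := Real.sqrt_pos.2 hd
  have hpos : ∀ i ∈ A, 0 < w i := fun i hi => (div_pos h0 hsd).trans_le (hw.lower i hi)
  set f := scaleFactor A bmax w with hf
  set m := L.sup' hne w with hm
  have hwm : ∀ i ∈ L, w i ≤ m := fun i hi => Finset.le_sup' w hi
  have hm0 : 0 < m := by
    obtain ⟨i, hi⟩ := hne
    exact (hpos i (hLA hi)).trans_le (hwm i hi)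
  have hm1 : m ≤ 1 / √(A.card : ℝ) :=
    Finset.sup'_le _ _ fun i hi => (Finset.mem_filter.1 hi).2.le
  have hS : 0 < ∑ i ∈ L, w i ^ 2 := Finset.sum_pos (fun i hi => pow_pos (hpos i (hLA hi)) 2) hne
  have hquot : 0 < (1 - ∑ i ∈ A, w i ^ 2) / ∑ i ∈ L, w i ^ 2 := div_pos (by linarith) hS
  have hf' : f = min (bmax / √(A.card : ℝ) / m)
      (√(1 + (1 - ∑ i ∈ A, w i ^ 2) / ∑ i ∈ L, w i ^ 2)) := by
    rw [hf, scaleFactor, dif_pos hne]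
  have hf1 : 1 ≤ f := by
    rw [hf']
    refine le_min ?_ ?_
    · rw [one_le_div hm0]
      exact hm1.trans (div_le_div_of_nonneg_right h2 hsd.le)
    · rw [Real.one_le_sqrt]
      linarith
  have hfm : f ≤ bmax / √(A.card : ℝ) / m := hf' ▸ min_le_left _ _
  have hfsq : f ^ 2 ≤ 1 + (1 - ∑ i ∈ A, w i ^ 2) / ∑ i ∈ L, w i ^ 2 := by
    rw [← Real.sq_sqrt (show 0 ≤ 1 + (1 - ∑ i ∈ A, w i ^ 2) / ∑ i ∈ L, w i ^ 2 by linarith)]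
    exact pow_le_pow_left₀ (by linarith) (hf' ▸ min_le_right _ _) 2
  have hstep : ∀ i, PartitionSelection.userStep A bmax w i = if i ∈ L then f * w i else w i :=
    fun i => rfl
  refine ⟨fun i hi => ?_, fun i hi => ?_, ?_⟩
  · rw [hstep]
    split_ifs with hiL
    · exact (hw.lower i hi).trans (le_mul_of_one_le_left (hpos i hi).le hf1)
    · exact hw.lower i hi
  · rw [hstep]
    split_ifs with hiL
    · calc f * w i ≤ bmax / √(A.card : ℝ) / m * m :=
            mul_le_mul hfm (hwm i hiL) (hpos i hi).le (by linarith)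
        _ = _ := div_mul_cancel₀ _ hm0.ne'
    · exact hw.upper i hi
  · have e : ∑ i ∈ A, PartitionSelection.userStep A bmax w i ^ 2
        = ∑ i ∈ A, w i ^ 2 + (f ^ 2 - 1) * ∑ i ∈ L, w i ^ 2 := by
      rw [← Finset.sum_sdiff hLA, ← Finset.sum_sdiff hLA (f := fun i => w i ^ 2)]
      have a1 : ∑ i ∈ A \ L, PartitionSelection.userStep A bmax w i ^ 2
          = ∑ i ∈ A \ L, w i ^ 2 :=
        Finset.sum_congr rfl fun i hi => by rw [hstep, if_neg (Finset.mem_sdiff.1 hi).2]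
      have a2 : ∑ i ∈ L, PartitionSelection.userStep A bmax w i ^ 2
          = f ^ 2 * ∑ i ∈ L, w i ^ 2 := by
        rw [Finset.mul_sum]
        exact Finset.sum_congr rfl fun i hi => by rw [hstep, if_pos hi, mul_pow]
      rw [a1, a2]
      ring
    rw [e]
    have : (f ^ 2 - 1) * ∑ i ∈ L, w i ^ 2 ≤ 1 - ∑ i ∈ A, w i ^ 2 := by
      rw [← le_div_iff₀ hS]
      linarith
    linarith

lemma isBoundedWeight_userWeights (A : Finset ι) (b : ι → ℝ) {bmin bmax : ℝ} (h0 : 0 < bmin)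
    (h1 : bmin ≤ 1) (h2 : 1 ≤ bmax) :
    IsBoundedWeight A bmin bmax (userWeights A b bmin bmax) :=
  whileLoop_induction (isBoundedWeight_userInit A b h0.le h1 h2)
    fun _ hx hQ => hQ.userStep h0 h2 hx

/-- Needed because the biases of the two coupled runs agree only on the items of the old users. -/
lemma userWeights_congr {A : Finset ι} {b b' : ι → ℝ} (h : ∀ i ∈ A, b i = b' i) (bmin bmax : ℝ) :
    userWeights A b bmin bmax = userWeights A b' bmin bmax := by
  have hbw : ∀ i ∈ A, biasedWeight A b bmin i = biasedWeight A b' bmin i := fun i hi => by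
    simp only [biasedWeight, h i hi]
  have hf : (A.filter fun j => b j < 1) = A.filter fun j => b' j < 1 :=
    Finset.filter_congr fun i hi => by rw [h i hi]
  have hf' : (A.filter fun j => ¬ b j < 1) = A.filter fun j => ¬ b' j < 1 :=
    Finset.filter_congr fun i hi => by rw [h i hi]
  have hs : ∑ j ∈ A with b j < 1, biasedWeight A b bmin j ^ 2
      = ∑ j ∈ A with b' j < 1, biasedWeight A b' bmin j ^ 2 := by
    rw [hf]
    exact Finset.sum_congr rfl fun i hi => by rw [hbw i (Finset.mem_filter.1 hi).1]
  have : userInit A b bmin bmax = userInit A b' bmin bmax := by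
    ext i
    simp only [userInit, hs, hf']
    split_ifs with hi hb hb' hb'
    · exact hbw i hi
    · exact absurd (h i hi ▸ hb) hb'
    · exact absurd (h i hi ▸ hb') hb
    · rfl
    · rfl
  rw [userWeights, this, userWeights]

end UserWeights

/-! ### Measurability -/

section Measurability

variable {ι X : Type*} [MeasurableSpace X]

lemma measurableSet_finset_eq [DecidableEq ι] {U : Finset ι} {t : X → Finset ι}
    (htU : ∀ x, t x ⊆ U)
    (ht : ∀ i ∈ U, MeasurableSet {x | i ∈ t x}) (B : Finset ι) : MeasurableSet {x | t x = B} := by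
  by_cases hB : B ⊆ U
  · have : {x | t x = B} = ⋂ i ∈ U, {x | i ∈ t x ↔ i ∈ B} := by
      ext x
      simp only [Set.mem_ofPred_eq, Set.mem_iInter, Finset.ext_iff]
      exact ⟨fun h i _ => h i, fun h i => ⟨fun hi => (h i (htU x hi)).1 hi,
        fun hi => (h i (hB hi)).2 hi⟩⟩
    rw [this]
    refine Finset.measurableSet_biInter U fun i hi => ?_
    by_cases hiB : i ∈ B
    · simpa [hiB] using ht i hi
    · simp only [hiB, iff_false]
      exact (ht i hi).compl
  · convert MeasurableSet.empty
    ext x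
    simp only [Set.mem_ofPred_eq, Set.mem_empty_iff_false, iff_false]
    rintro rfl
    exact hB (htU x)

/-- A property that depends on `x` and on a finite set `t x` is measurable if it is so for every
value of the finite set, of which there are finitely many. -/
lemma measurableSet_of_finset_partition [DecidableEq ι] {U : Finset ι} {t : X → Finset ι}
    (htU : ∀ x, t x ⊆ U) (ht : ∀ i ∈ U, MeasurableSet {x | i ∈ t x}) {p : Finset ι → X → Prop}
    (hp : ∀ B ⊆ U, MeasurableSet {x | p B x}) : MeasurableSet {x | p (t x) x} := by
  have : {x | p (t x) x} = ⋃ B ∈ U.powerset, {x | t x = B} ∩ {x | p B x} := by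
    ext x
    simp only [Set.mem_ofPred_eq, Set.mem_iUnion, Set.mem_inter_iff, Finset.mem_powerset,
      exists_prop]
    exact ⟨fun h => ⟨t x, htU x, rfl, h⟩, fun ⟨B, _, hB, h⟩ => hB ▸ h⟩
  rw [this]
  exact Finset.measurableSet_biUnion _ fun B hB =>
    (measurableSet_finset_eq htU ht B).inter (hp B (Finset.mem_powerset.1 hB))

lemma measurable_of_finset_partition [DecidableEq ι] {U : Finset ι} {t : X → Finset ι}
    (htU : ∀ x, t x ⊆ U) (ht : ∀ i ∈ U, MeasurableSet {x | i ∈ t x}) {Y : Type*}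
    [MeasurableSpace Y] {f : Finset ι → X → Y} (hf : ∀ B ⊆ U, Measurable (f B)) :
    Measurable fun x => f (t x) x := fun s hs =>
  measurableSet_of_finset_partition htU ht (p := fun B x => f B x ∈ s) fun B hB => hf B hB hs

/-- Split according to the exit time: a countable union, together with the non-terminating runs, on
which the loop is the identity. -/
lemma measurable_whileLoop {α : Type*} [MeasurableSpace α] {guard : α → Prop} {body : α → α}
    (hg : MeasurableSet {x | guard x}) (hb : Measurable body) :
    Measurable (whileLoop guard body) := by
  classical
  intro s hs
  have hgn : ∀ n, MeasurableSet {x | guard (body^[n] x)} := fun n => (hb.iterate n) hg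
  have hterm : MeasurableSet {x | ∃ n, ¬ guard (body^[n] x)} := by
    have : {x | ∃ n, ¬ guard (body^[n] x)} = ⋃ n, {x | guard (body^[n] x)}ᶜ := by
      ext x; simp
    rw [this]
    exact MeasurableSet.iUnion fun n => (hgn n).compl
  have : whileLoop guard body ⁻¹' s =
      ({x | ∃ n, ¬ guard (body^[n] x)}ᶜ ∩ s) ∪
      ⋃ n, ({x | guard (body^[n] x)}ᶜ ∩ ⋂ m ∈ Finset.range n, {x | guard (body^[m] x)}) ∩
        (body^[n]) ⁻¹' s := by
    ext x
    simp only [Set.mem_preimage, whileLoop, Set.mem_union, Set.mem_inter_iff, Set.mem_compl_iff,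
      Set.mem_ofPred_eq, Set.mem_iUnion, Set.mem_iInter, Finset.mem_range]
    split_ifs with h
    · constructor
      · intro hx
        exact Or.inr ⟨Nat.find h, ⟨Nat.find_spec h, fun m hm => not_not.1 (Nat.find_min h hm)⟩, hx⟩
      · rintro (⟨hn, _⟩ | ⟨n, ⟨hn, hlt⟩, hx⟩)
        · exact absurd h hn
        · have : Nat.find h = n :=
            (Nat.find_eq_iff h).2 ⟨hn, fun m hm => not_not.2 (hlt m hm)⟩
          rwa [this]
    · constructor
      · exact fun hx => Or.inl ⟨h, hx⟩
      · rintro (⟨_, hx⟩ | ⟨n, ⟨hn, _⟩, _⟩)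
        · exact hx
        · exact absurd ⟨n, hn⟩ h
  rw [this]
  refine (hterm.compl.inter hs).union (MeasurableSet.iUnion fun n => ?_)
  exact ((hgn n).compl.inter (Finset.measurableSet_biInter _ fun m _ => hgn m)).inter
    ((hb.iterate n) hs)

variable [DecidableEq ι]

lemma measurable_userInit (A : Finset ι) (bmin bmax : ℝ) :
    Measurable fun b : ι → ℝ => userInit A b bmin bmax := by
  have hlt : ∀ i, MeasurableSet {b : ι → ℝ | b i < 1} := fun i =>
    measurableSet_lt (measurable_pi_apply i) measurable_const
  have hbw : ∀ i, Measurable fun b : ι → ℝ => biasedWeight A b bmin i := fun i => by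
    unfold biasedWeight
    fun_prop
  refine measurable_pi_iff.2 fun i => ?_
  by_cases hi : i ∈ A
  swap
  · simp only [userInit, hi, if_false]
    exact measurable_const
  simp only [userInit, hi, if_true]
  refine Measurable.ite (hlt i) (hbw i) (measurable_const.min (Measurable.sqrt ?_))
  have h1 : ∀ b : ι → ℝ, ∑ j ∈ A with b j < 1, biasedWeight A b bmin j ^ 2
      = ∑ j ∈ A, if b j < 1 then biasedWeight A b bmin j ^ 2 else 0 :=
    fun b => Finset.sum_filter _ _
  have h2 : ∀ b : ι → ℝ, ((A.filter fun j => ¬ b j < 1).card : ℝ)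
      = ∑ j ∈ A, if b j < 1 then (0 : ℝ) else 1 := fun b => by
    rw [Finset.card_filter, Nat.cast_sum]
    refine Finset.sum_congr rfl fun j _ => ?_
    split_ifs <;> simp_all
  simp_rw [h1, h2]
  refine (measurable_const.sub (Finset.measurable_sum _ fun j _ => ?_)).div
    (Finset.measurable_sum _ fun j _ => ?_)
  · exact Measurable.ite (hlt j) ((hbw j).pow_const 2) measurable_const
  · exact Measurable.ite (hlt j) measurable_const measurable_const

lemma measurable_userStep (A : Finset ι) (bmax : ℝ) :
    Measurable (userStep A bmax : (ι → ℝ) → ι → ℝ) := by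
  refine measurable_pi_iff.2 fun i => ?_
  refine measurable_of_finset_partition (U := A) (t := smallItems A)
    (f := fun L w => if i ∈ L then min
      (bmax / √(A.card : ℝ) / (if h : L.Nonempty then L.sup' h w else 0))
      (√(1 + (1 - ∑ i ∈ A, w i ^ 2) / ∑ i ∈ L, w i ^ 2)) * w i else w i)
    (fun w => Finset.filter_subset _ _) (fun j hj => ?_) (fun L _ => ?_)
  · simp only [smallItems, Finset.mem_filter, hj, true_and]
    exact measurableSet_lt (measurable_pi_apply j) measurable_const
  · by_cases hi : i ∈ L
    · have hL : L.Nonempty := ⟨i, hi⟩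
      simp only [hi, hL, if_true, dif_pos]
      have : Measurable fun w : ι → ℝ => L.sup' hL w := by
        have := Finset.measurable_sup' hL (f := fun i (w : ι → ℝ) => w i)
          fun i _ => measurable_pi_apply i
        convert this using 2 with w
        rw [Finset.sup'_apply]
      fun_prop
    · simp only [hi, if_false]
      fun_prop

/-- Measurability in `b` matters because the biases of round 2 are functions of the noise of round
1. -/
lemma measurable_userWeights (A : Finset ι) (bmin bmax : ℝ) :
    Measurable fun b : ι → ℝ => userWeights A b bmin bmax := by
  refine (measurable_whileLoop ?_ (measurable_userStep A bmax)).comp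
    (measurable_userInit A bmin bmax)
  exact measurableSet_lt (by fun_prop) measurable_const

end Measurability

/-! ### Real inequalities behind the sensitivity of `MAD` -/

section Inequalities

variable {υ ι : Type*}

/-- The ratio is `1 - τ/w` for `w > 0`, and division by zero makes it 0 at `w = 0`. -/
lemma max_sub_div_mono {τ w w' : ℝ} (hτ : 0 ≤ τ) (hw : 0 ≤ w) (h : w ≤ w') :
    max 0 ((w - τ) / w) ≤ max 0 ((w' - τ) / w') := by
  rcases hw.eq_or_lt with rfl | hw
  · simp
  · refine max_le_max le_rfl ?_
    rw [div_le_div_iff₀ hw (hw.trans_le h)]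
    nlinarith

lemma mul_max_sub_div {τ w : ℝ} (hτ : 0 ≤ τ) (hw : 0 ≤ w) :
    w * max 0 ((w - τ) / w) = w - min w τ := by
  rcases hw.eq_or_lt with rfl | hw
  · simp [hτ]
  · rw [mul_max_of_nonneg _ _ hw.le, mul_zero, mul_div_cancel₀ _ hw.ne']
    rcases le_total w τ with h | h
    · rw [min_eq_left h, max_eq_left (by linarith)]
      ring
    · rw [min_eq_right h, max_eq_right (by linarith)]

/-- The triangle inequality in `ℓ₂` for vectors of lengths at most `1 - q` and `q`, through
Cauchy–Schwarz on the cross term. -/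
lemma sum_add_sq_le_one {W : Finset ι} {y r : ι → ℝ} {q : ℝ} (hq0 : 0 ≤ q) (hq1 : q ≤ 1)
    (hy : ∑ i ∈ W, y i ^ 2 ≤ (1 - q) ^ 2) (hr : ∑ i ∈ W, r i ^ 2 ≤ q ^ 2) :
    ∑ i ∈ W, (y i + r i) ^ 2 ≤ 1 := by
  have hcs : (∑ i ∈ W, y i * r i) ^ 2 ≤ ((1 - q) * q) ^ 2 := by
    rw [mul_pow]
    exact (Finset.sum_mul_sq_le_sq_mul_sq W y r).trans
      (mul_le_mul hy hr (Finset.sum_nonneg fun _ _ => sq_nonneg _) (sq_nonneg _))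
  have h := abs_le.1 (abs_le_of_sq_le_sq hcs (mul_nonneg (by linarith) hq0))
  have e : ∑ i ∈ W, (y i + r i) ^ 2
      = ∑ i ∈ W, y i ^ 2 + 2 * ∑ i ∈ W, y i * r i + ∑ i ∈ W, r i ^ 2 := by
    rw [Finset.mul_sum, ← Finset.sum_add_distrib, ← Finset.sum_add_distrib]
    exact Finset.sum_congr rfl fun i _ => by ring
  rw [e]
  nlinarith [h.1, h.2]

/-- Minkowski for the vectors `c u • 1_{A u}`, of norm at most `√m * c u`. In the expanded square,
dropping one of the two indicators leaves at most `m` items per pair of users. -/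
lemma sum_sq_sum_ite_le [DecidableEq ι] {W : Finset ι} {I : Finset υ} {A : υ → Finset ι} {c : υ → ℝ} {m : ℝ}
    (hc : ∀ u ∈ I, 0 ≤ c u) (hA : ∀ u ∈ I, ((A u).card : ℝ) ≤ m) :
    ∑ i ∈ W, (∑ u ∈ I, if i ∈ A u then c u else 0) ^ 2 ≤ m * (∑ u ∈ I, c u) ^ 2 := by
  have e : ∀ i, (∑ u ∈ I, if i ∈ A u then c u else 0) ^ 2
      ≤ ∑ u ∈ I, ∑ u' ∈ I, if i ∈ A u then c u * c u' else 0 := by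
    intro i
    rw [sq, Finset.sum_mul_sum]
    refine Finset.sum_le_sum fun u hu => Finset.sum_le_sum fun u' hu' => ?_
    have := mul_nonneg (hc u hu) (hc u' hu')
    split_ifs <;> simp_all
  calc _ ≤ ∑ i ∈ W, ∑ u ∈ I, ∑ u' ∈ I, (if i ∈ A u then c u * c u' else 0) :=
        Finset.sum_le_sum fun i _ => e i
    _ = ∑ u ∈ I, ∑ u' ∈ I, ∑ i ∈ W, (if i ∈ A u then c u * c u' else 0) := by
        rw [Finset.sum_comm]
        exact Finset.sum_congr rfl fun u _ => Finset.sum_comm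
    _ ≤ ∑ u ∈ I, ∑ u' ∈ I, m * (c u * c u') := by
        refine Finset.sum_le_sum fun u hu => Finset.sum_le_sum fun u' hu' => ?_
        rw [← Finset.sum_filter, Finset.sum_const, nsmul_eq_mul]
        refine mul_le_mul_of_nonneg_right (le_trans ?_ (hA u hu))
          (mul_nonneg (hc u hu) (hc u' hu'))
        exact_mod_cast Finset.card_le_card fun i hi => (Finset.mem_filter.1 hi).2
    _ = m * (∑ u ∈ I, c u) ^ 2 := by
        rw [sq, Finset.sum_mul_sum, Finset.mul_sum]
        exact Finset.sum_congr rfl fun u _ => (Finset.mul_sum _ _ _).symm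

/-- Expand the square and use `w i ≥ a` in the cross term and `ξ i ^ 2 ≤ k * ξ i`. -/
lemma sum_sub_sq_le {A : Finset ι} {w ξ : ι → ℝ} {a k : ℝ} (hw : ∀ i ∈ A, a ≤ w i)
    (hw1 : ∑ i ∈ A, w i ^ 2 ≤ 1) (hξ0 : ∀ i ∈ A, 0 ≤ ξ i) (hξk : ∀ i ∈ A, ξ i ≤ k) :
    ∑ i ∈ A, (w i - ξ i) ^ 2 ≤ 1 - (2 * a - k) * ∑ i ∈ A, ξ i := by
  have : ∑ i ∈ A, (w i - ξ i) ^ 2 ≤ ∑ i ∈ A, (w i ^ 2 - (2 * a - k) * ξ i) := by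
    refine Finset.sum_le_sum fun i hi => ?_
    nlinarith [mul_nonneg (sub_nonneg.2 (hw i hi)) (hξ0 i hi),
      mul_nonneg (sub_nonneg.2 (hξk i hi)) (hξ0 i hi)]
  rw [Finset.sum_sub_distrib, ← Finset.mul_sum] at this
  linarith

lemma discount_nonneg {dmax bmin : ℝ} (hd : 1 < dmax) (hb : 1 / 2 ≤ bmin) :
    0 ≤ discount dmax bmin := by
  have : 1 ≤ √dmax := Real.one_le_sqrt.2 hd.le
  have : 1 / (2 * √dmax) ≤ 1 / 2 := one_div_le_one_div_of_le (by norm_num) (by linarith)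
  rw [discount]
  linarith

/-- The slack that the discount leaves for a user of degree `d`. -/
lemma one_sub_mul_le_sq {d dmax bmin D : ℝ} (hd0 : 0 < d) (hd : 1 ≤ bmin ^ 2 * d)
    (hb : 0 < bmin) (hdm : d ≤ dmax) (hD : 0 ≤ D) :
    1 - (2 * (bmin / √d) - 1 / d) * D ≤ (1 - discount dmax bmin * D / √dmax) ^ 2 := by
  have hs : 0 < √d := Real.sqrt_pos.2 hd0
  have hsm : √d ≤ √dmax := Real.sqrt_le_sqrt hdm
  have hm : 0 < √dmax := hs.trans_le hsm
  set x := 1 / √d with hx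
  set y := 1 / √dmax with hy
  have hyx : y ≤ x := one_div_le_one_div_of_le hs hsm
  -- The minimum degree of adaptive users enters here: it places `y ≤ x` in the range where `z ↦ 2
  -- bmin z - z²` is increasing.
  have hxb : x ≤ bmin := by
    rw [hx, div_le_iff₀ hs]
    rw [← one_le_sq_iff₀ (by positivity), mul_pow, Real.sq_sqrt hd0.le]
    exact hd
  have e1 : 2 * (bmin / √d) - 1 / d = 2 * bmin * x - x ^ 2 := by
    rw [hx, div_pow, Real.sq_sqrt hd0.le]
    ring
  -- With `α = bmin - y/2`, twice this quantity is `(2 bmin y - y²) D`. The left side of the goal is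
  -- therefore at most `1 - 2q ≤ (1 - q)²`, where `q` denotes this quantity.
  have e2 : discount dmax bmin * D / √dmax = (bmin * y - y ^ 2 / 2) * D := by
    rw [discount, hy]
    field_simp
  rw [e1, e2]
  have h1 : 2 * bmin * y - y ^ 2 ≤ 2 * bmin * x - x ^ 2 := by nlinarith
  nlinarith [mul_le_mul_of_nonneg_right h1 hD, sq_nonneg ((bmin * y - y ^ 2 / 2) * D)]

/-- The weight rerouted to a new item is compensated by the items of the user that are not new. -/
lemma inv_sqrt_add_discount_le {d t : ℕ} {dmax bmin : ℝ} (ht : 1 ≤ t) (htd : t ≤ d)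
    (hb : bmin ≤ 1) (hdm : (d : ℝ) ≤ dmax) :
    1 / √(d : ℝ) + discount dmax bmin * ((d - t) / d) / dmax ≤ 1 / √(t : ℝ) := by
  have ht' : (1 : ℝ) ≤ t := by exact_mod_cast ht
  have htd' : (t : ℝ) ≤ d := by exact_mod_cast htd
  set p := √(d : ℝ) with hp
  set q := √(t : ℝ) with hq
  set m := √dmax with hm
  have hq1 : 1 ≤ q := Real.one_le_sqrt.2 ht'
  have hqp : q ≤ p := Real.sqrt_le_sqrt htd'
  have hpm : p ≤ m := Real.sqrt_le_sqrt hdm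
  have ed : (d : ℝ) = p ^ 2 := (Real.sq_sqrt (by linarith)).symm
  have et : (t : ℝ) = q ^ 2 := (Real.sq_sqrt (by linarith)).symm
  have em : dmax = m ^ 2 := (Real.sq_sqrt (by linarith)).symm
  have hp1 : 1 ≤ p := hq1.trans hqp
  have hm1 : 1 ≤ m := hp1.trans hpm
  -- The worst case is `bmin = 1` and `dmax = d`, since `(1 - 1/(2x))/x²` decreases on `x ≥ 1`.
  have hα : discount dmax bmin / dmax ≤ (1 - 1 / (2 * p)) / p ^ 2 := by
    have h1 : discount dmax bmin / dmax ≤ (1 - 1 / (2 * m)) / m ^ 2 := by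
      rw [discount, ← hm, em]
      gcongr
    refine h1.trans ?_
    have e : ∀ x : ℝ, 0 < x → (1 - 1 / (2 * x)) / x ^ 2 = (2 * x - 1) / (2 * x ^ 3) := by
      intro x hx
      field_simp
    rw [e m (by linarith), e p (by linarith), div_le_div_iff₀ (by positivity) (by positivity)]
    have h2 : p ^ 2 * (2 * m - 1) ≤ m ^ 2 * (2 * p - 1) := by
      nlinarith [mul_nonneg (sub_nonneg.2 hpm) (sub_nonneg.2 hp1),
        mul_nonneg (sub_nonneg.2 hpm) (sub_nonneg.2 hm1),
        mul_nonneg (sub_nonneg.2 hp1) (sub_nonneg.2 hm1)]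
    have h3 : (2 * m - 1) * p ^ 3 ≤ (2 * p - 1) * m ^ 3 := by
      nlinarith [mul_le_mul_of_nonneg_left h2 (by linarith : 0 ≤ p),
        mul_nonneg (mul_nonneg (sq_nonneg m) (sub_nonneg.2 hpm)) (by linarith : 0 ≤ 2 * p - 1)]
    nlinarith
  have hr0 : 0 ≤ ((d : ℝ) - t) / d := div_nonneg (by linarith) (by linarith)
  calc 1 / p + discount dmax bmin * ((d - t) / d) / dmax
      = 1 / p + discount dmax bmin / dmax * ((d - t) / d) := by ring
    _ ≤ 1 / p + (1 - 1 / (2 * p)) / p ^ 2 * ((d - t) / d) := by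
        gcongr
    _ ≤ 1 / q := by
        rw [ed, et]
        have e : 1 / p + (1 - 1 / (2 * p)) / p ^ 2 * ((p ^ 2 - q ^ 2) / p ^ 2)
            = (2 * p ^ 4 + (2 * p - 1) * (p ^ 2 - q ^ 2)) / (2 * p ^ 5) := by
          field_simp
        rw [e, div_le_div_iff₀ (by positivity) (by positivity)]
        -- What remains after cancelling the factor `p - q`; it follows from `q ≤ p` and `(p - 1)² ≥
        -- 0`.
        have h1 : q * (p + q) * (2 * p - 1) ≤ 2 * p ^ 4 := by
          have : q * (p + q) ≤ p * (p + p) := by nlinarith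
          nlinarith [mul_le_mul_of_nonneg_right this (by linarith : 0 ≤ 2 * p - 1),
            mul_nonneg (sq_nonneg p) (sq_nonneg (p - 1))]
        nlinarith [mul_le_mul_of_nonneg_left h1 (by linarith : 0 ≤ p - q)]

end Inequalities

/-! ### Sensitivity of `MAD` -/

section Sensitivity

variable {υ ι : Type*}

section AdaptiveUsers

variable {dmax bmin : ℝ}

lemma adaptiveUsers_subset (S : Dataset υ ι) (dmax bmin : ℝ) :
    adaptiveUsers S dmax bmin ⊆ S.users := Finset.filter_subset _ _

/-- A user with item set `A` participates in adaptive reweighting. -/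
def IsAdaptive (A : Finset ι) (dmax bmin : ℝ) : Prop :=
  ⌈1 / bmin ^ 2⌉₊ ≤ A.card ∧ (A.card : ℝ) ≤ dmax

lemma mem_adaptiveUsers {S : Dataset υ ι} {u : υ} :
    u ∈ adaptiveUsers S dmax bmin ↔ u ∈ S.users ∧ IsAdaptive (S.items u) dmax bmin :=
  Finset.mem_filter

lemma IsAdaptive.one_le {A : Finset ι} (h : IsAdaptive A dmax bmin) (hb : 0 < bmin) :
    1 ≤ bmin ^ 2 * A.card := by
  have := (Nat.le_ceil _).trans (Nat.cast_le.2 h.1 : ((⌈1 / bmin ^ 2⌉₊ : ℕ) : ℝ) ≤ _)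
  rw [div_le_iff₀ (by positivity)] at this
  linarith

lemma IsAdaptive.card_pos {A : Finset ι} (h : IsAdaptive A dmax bmin) (hb : 0 < bmin) :
    0 < (A.card : ℝ) := by
  have := h.one_le hb
  by_contra! hc
  nlinarith [sq_nonneg bmin]

lemma adaptiveUsers_insert_of_isAdaptive [DecidableEq υ] {V : Finset υ} {A : υ → Finset ι} {v : υ}
    (hv : IsAdaptive (A v) dmax bmin) :
    adaptiveUsers ⟨insert v V, A⟩ dmax bmin = insert v (adaptiveUsers ⟨V, A⟩ dmax bmin) := by
  ext u
  simp only [mem_adaptiveUsers, Finset.mem_insert]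
  constructor
  · rintro ⟨rfl | h, h'⟩
    exacts [Or.inl rfl, Or.inr ⟨h, h'⟩]
  · rintro (rfl | h)
    exacts [⟨Or.inl rfl, hv⟩, ⟨Or.inr h.1, h.2⟩]

lemma adaptiveUsers_insert_of_not [DecidableEq υ] {V : Finset υ} {A : υ → Finset ι} {v : υ}
    (hv : ¬ IsAdaptive (A v) dmax bmin) :
    adaptiveUsers ⟨insert v V, A⟩ dmax bmin = adaptiveUsers ⟨V, A⟩ dmax bmin := by
  ext u
  simp only [mem_adaptiveUsers, Finset.mem_insert]
  constructor
  · rintro ⟨rfl | h, h'⟩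
    exacts [absurd h' hv, ⟨h, h'⟩]
  · exact fun h => ⟨Or.inr h.1, h.2⟩

end AdaptiveUsers

variable [DecidableEq ι]

lemma mem_union {S : Dataset υ ι} {i : ι} : i ∈ S.union ↔ ∃ u ∈ S.users, i ∈ S.items u :=
  Finset.mem_biUnion

lemma wInit_nonneg (S : Dataset υ ι) (dmax bmin : ℝ) (i : ι) : 0 ≤ wInit S dmax bmin i :=
  Finset.sum_nonneg fun _ _ => one_div_nonneg.2 (Nat.cast_nonneg _)

lemma excessRatio_nonneg (S : Dataset υ ι) (τ dmax bmin : ℝ) (i : ι) :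
    0 ≤ excessRatio S τ dmax bmin i := le_max_left _ _

lemma excessRatio_le_one (S : Dataset υ ι) {τ : ℝ} (hτ : 0 ≤ τ) (dmax bmin : ℝ) (i : ι) :
    excessRatio S τ dmax bmin i ≤ 1 := by
  refine max_le zero_le_one (div_le_one_of_le₀ ?_ (wInit_nonneg S dmax bmin i))
  linarith

lemma userExcess_nonneg (S : Dataset υ ι) (τ dmax bmin : ℝ) (u : υ) :
    0 ≤ userExcess S τ dmax bmin u :=
  mul_nonneg (one_div_nonneg.2 (Nat.cast_nonneg _))
    (Finset.sum_nonneg fun _ _ => excessRatio_nonneg _ _ _ _ _)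

/-- The total excess returned to the users is the weight lost by truncation. -/
lemma sum_userExcess (S : Dataset υ ι) {τ : ℝ} (hτ : 0 ≤ τ) (dmax bmin : ℝ) {W : Finset ι}
    (hW : S.union ⊆ W) :
    ∑ u ∈ adaptiveUsers S dmax bmin, userExcess S τ dmax bmin u
      = ∑ i ∈ W, (wInit S dmax bmin i - wTrunc S τ dmax bmin i) := by
  have h1 : ∀ u ∈ adaptiveUsers S dmax bmin, userExcess S τ dmax bmin u
      = ∑ i ∈ W, if i ∈ S.items u then 1 / deg S u * excessRatio S τ dmax bmin i else 0 := by
    intro u hu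
    rw [userExcess, Finset.mul_sum, Finset.sum_ite_mem, Finset.inter_eq_right.2]
    exact fun i hi => hW (mem_union.2 ⟨u, adaptiveUsers_subset _ _ _ hu, hi⟩)
  rw [Finset.sum_congr rfl h1, Finset.sum_comm]
  refine Finset.sum_congr rfl fun i _ => ?_
  rw [← Finset.sum_filter, ← Finset.sum_mul]
  exact mul_max_sub_div hτ (wInit_nonneg S dmax bmin i)

/-- Lets the dataset without the new user be written with the item function of the larger one, as
the insertion lemmas require. -/
lemma mad_congr [DecidableEq υ] {S T : Dataset υ ι} (hu : T.users = S.users)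
    (hi : ∀ u ∈ S.users, T.items u = S.items u)
    {b b' : ι → ℝ} (hb : ∀ i ∈ S.union, b' i = b i) (τ dmax bmin bmax : ℝ) :
    mad T τ dmax b' bmin bmax = mad S τ dmax b bmin bmax := by
  have hdeg : ∀ u ∈ S.users, deg T u = deg S u := fun u h => by rw [deg, hi u h, deg]
  have ha : adaptiveUsers T dmax bmin = adaptiveUsers S dmax bmin := by
    rw [adaptiveUsers, hu]
    exact Finset.filter_congr fun u h => by rw [hi u h, hdeg u h]
  have hf : ∀ V : Finset υ, V ⊆ S.users → ∀ i,
      (V.filter fun u => i ∈ T.items u) = V.filter fun u => i ∈ S.items u :=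
    fun V hV i => Finset.filter_congr fun u h => by rw [hi u (hV h)]
  have hasub := adaptiveUsers_subset S dmax bmin
  have hw : ∀ i, wInit T dmax bmin i = wInit S dmax bmin i := fun i => by
    rw [wInit, ha, hf _ hasub, wInit]
    exact Finset.sum_congr rfl fun u h => by rw [hdeg u (hasub (Finset.mem_filter.1 h).1)]
  have hr : ∀ i, excessRatio T τ dmax bmin i = excessRatio S τ dmax bmin i := fun i => by
    rw [excessRatio, hw, excessRatio]
  have he : ∀ u ∈ S.users, userExcess T τ dmax bmin u = userExcess S τ dmax bmin u :=
    fun u h => by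
      rw [userExcess, hdeg u h, hi u h, userExcess]
      simp_rw [hr]
  have hU : ∀ u ∈ S.users, userWeights (T.items u) b' bmin bmax
      = userWeights (S.items u) b bmin bmax := fun u h => by
    rw [hi u h]
    exact userWeights_congr (fun i hiu => hb i (mem_union.2 ⟨u, h, hiu⟩)) _ _
  ext i
  rw [mad, mad, wTrunc, wTrunc, hw, wReroute, wReroute, ha, hu, hf _ hasub,
    hf _ Finset.sdiff_subset]
  congr 1
  · congr 1
    · congr 1
      exact Finset.sum_congr rfl fun u h => by rw [he u (hasub (Finset.mem_filter.1 h).1)]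
    · refine Finset.sum_congr rfl fun u h => ?_
      rw [hU u (hasub (Finset.mem_filter.1 h).1), hdeg u (hasub (Finset.mem_filter.1 h).1)]
  · refine Finset.sum_congr rfl fun u h => ?_
    rw [hU u (Finset.mem_sdiff.1 (Finset.mem_filter.1 h).1).1]

/-! ### The effect of one additional user on the weights. -/

section Insert

variable [DecidableEq υ] {V : Finset υ} {A : υ → Finset ι} {v : υ} {dmax bmin : ℝ}

lemma mad_insert_of_not (hvV : v ∉ V) (hv : ¬ IsAdaptive (A v) dmax bmin) (τ : ℝ) (b : ι → ℝ)
    (bmax : ℝ) (i : ι) :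
    mad ⟨insert v V, A⟩ τ dmax b bmin bmax i = mad ⟨V, A⟩ τ dmax b bmin bmax i
      + if i ∈ A v then userWeights (A v) b bmin bmax i else 0 := by
  have ha := adaptiveUsers_insert_of_not (V := V) hv
  have hw : ∀ i, wInit ⟨insert v V, A⟩ dmax bmin i = wInit ⟨V, A⟩ dmax bmin i := fun i => by
    simp only [wInit, ha, deg]
  have he : ∀ u, userExcess ⟨insert v V, A⟩ τ dmax bmin u
      = userExcess ⟨V, A⟩ τ dmax bmin u := fun u => by
    simp only [userExcess, excessRatio, hw, deg]
  have hva : v ∉ adaptiveUsers ⟨V, A⟩ dmax bmin := fun h => hvV (adaptiveUsers_subset _ _ _ h)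
  have hs : insert v V \ adaptiveUsers ⟨V, A⟩ dmax bmin
      = insert v (V \ adaptiveUsers ⟨V, A⟩ dmax bmin) := Finset.insert_sdiff_of_notMem _ hva
  simp only [mad, wTrunc, hw, wReroute, he, ha, hs, deg]
  rw [Finset.sum_filter, Finset.sum_filter, Finset.sum_filter, Finset.sum_filter,
    Finset.sum_insert (fun h => hvV (Finset.mem_sdiff.1 h).1)]
  ring

lemma wInit_insert (hvV : v ∉ V) (hv : IsAdaptive (A v) dmax bmin) (i : ι) :
    wInit ⟨insert v V, A⟩ dmax bmin i = wInit ⟨V, A⟩ dmax bmin i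
      + if i ∈ A v then 1 / ((A v).card : ℝ) else 0 := by
  have hva : v ∉ adaptiveUsers ⟨V, A⟩ dmax bmin := fun h => hvV (adaptiveUsers_subset _ _ _ h)
  simp only [wInit, adaptiveUsers_insert_of_isAdaptive hv, deg]
  rw [Finset.sum_filter, Finset.sum_insert hva, Finset.sum_filter, add_comm]

/-- The change of the weights when an adaptive user is added. -/
lemma mad_insert_of_isAdaptive (hvV : v ∉ V) (hv : IsAdaptive (A v) dmax bmin) (τ : ℝ)
    (b : ι → ℝ) (bmax : ℝ) (i : ι) :
    mad ⟨insert v V, A⟩ τ dmax b bmin bmax i = mad ⟨V, A⟩ τ dmax b bmin bmax i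
      + ((wTrunc ⟨insert v V, A⟩ τ dmax bmin i - wTrunc ⟨V, A⟩ τ dmax bmin i
          + if i ∈ A v then userWeights (A v) b bmin bmax i - 1 / ((A v).card : ℝ) else 0)
        + (wReroute ⟨insert v V, A⟩ τ dmax bmin i - wReroute ⟨V, A⟩ τ dmax bmin i)) := by
  have hva : v ∉ adaptiveUsers ⟨V, A⟩ dmax bmin := fun h => hvV (adaptiveUsers_subset _ _ _ h)
  have hs : insert v V \ insert v (adaptiveUsers ⟨V, A⟩ dmax bmin)
      = V \ adaptiveUsers ⟨V, A⟩ dmax bmin := by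
    rw [Finset.insert_sdiff_insert, Finset.sdiff_insert_of_notMem hvV]
  simp only [mad, adaptiveUsers_insert_of_isAdaptive hv, hs, deg]
  rw [Finset.sum_filter, Finset.sum_insert hva, Finset.sum_filter, Finset.sum_filter]
  ring

/-- The change becomes one sum over all adaptive users once the earlier excess of `v` is counted as
0. The case distinction is needed because `userExcess ⟨V, A⟩` is also defined at `v ∉ V` and need
not vanish there. -/
lemma wReroute_insert_sub (hvV : v ∉ V) (hv : IsAdaptive (A v) dmax bmin) (τ : ℝ) (i : ι) :
    wReroute ⟨insert v V, A⟩ τ dmax bmin i - wReroute ⟨V, A⟩ τ dmax bmin i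
      = ∑ u ∈ adaptiveUsers ⟨insert v V, A⟩ dmax bmin, if i ∈ A u then
          discount dmax bmin * (userExcess ⟨insert v V, A⟩ τ dmax bmin u
            - if u = v then 0 else userExcess ⟨V, A⟩ τ dmax bmin u) / dmax else 0 := by
  have hva : v ∉ adaptiveUsers ⟨V, A⟩ dmax bmin := fun h => hvV (adaptiveUsers_subset _ _ _ h)
  simp only [wReroute, adaptiveUsers_insert_of_isAdaptive hv]
  rw [Finset.sum_filter, Finset.sum_filter, Finset.sum_insert hva, Finset.sum_insert hva,
    if_pos rfl, sub_zero, add_sub_assoc, ← Finset.sum_sub_distrib]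
  congr 1
  refine Finset.sum_congr rfl fun u hu => ?_
  have huv : u ≠ v := fun h => hva (h ▸ hu)
  split_ifs
  · ring
  · simp

lemma userExcess_insert_mono (hvV : v ∉ V) (hv : IsAdaptive (A v) dmax bmin) {τ : ℝ}
    (hτ : 0 ≤ τ) (u : υ) :
    userExcess ⟨V, A⟩ τ dmax bmin u ≤ userExcess ⟨insert v V, A⟩ τ dmax bmin u := by
  refine mul_le_mul_of_nonneg_left (Finset.sum_le_sum fun i _ => ?_)
    (one_div_nonneg.2 (Nat.cast_nonneg _))
  refine max_sub_div_mono hτ (wInit_nonneg _ _ _ _) ?_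
  rw [wInit_insert hvV hv, le_add_iff_nonneg_right]
  positivity

/-- For adaptive `v` the change splits into a direct part, supported on `A v`, and a rerouted part.
The mass `D` lost to truncation shortens the direct part enough to pay for the rerouting. -/
lemma sum_mad_insert_sub_sq_le (hvV : v ∉ V) {τ bmax : ℝ} (b : ι → ℝ) (hτ : 0 ≤ τ)
    (hd : 1 < dmax) (hb0 : 1 / 2 ≤ bmin) (hb1 : bmin ≤ 1) (hb2 : 1 ≤ bmax) :
    ∑ i ∈ Dataset.union ⟨insert v V, A⟩, (mad ⟨insert v V, A⟩ τ dmax b bmin bmax i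
      - mad ⟨V, A⟩ τ dmax b bmin bmax i) ^ 2 ≤ 1 := by
  have hbpos : 0 < bmin := by linarith
  have hw := isBoundedWeight_userWeights (A v) b hbpos hb1 hb2
  have hAW : A v ⊆ Dataset.union ⟨insert v V, A⟩ := fun i hi =>
    mem_union.2 ⟨v, Finset.mem_insert_self _ _, hi⟩
  set W := Dataset.union ⟨insert v V, A⟩
  by_cases hv : IsAdaptive (A v) dmax bmin
  swap
  · simp_rw [mad_insert_of_not hvV hv, add_sub_cancel_left, ite_pow, zero_pow two_ne_zero]
    rw [Finset.sum_ite_mem, Finset.inter_eq_right.2 hAW]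
    exact hw.sum_sq
  have hd0 := hv.card_pos hbpos
  set d : ℝ := ((A v).card : ℝ) with hd_def
  -- The part of the contribution `1/d` of `v` to an item that truncation removes.
  set ξ : ι → ℝ := fun i => 1 / d - (wTrunc ⟨insert v V, A⟩ τ dmax bmin i
    - wTrunc ⟨V, A⟩ τ dmax bmin i) with hξ
  set x : υ → ℝ := fun u => userExcess ⟨insert v V, A⟩ τ dmax bmin u
            - if u = v then 0 else userExcess ⟨V, A⟩ τ dmax bmin u with hx
  set D := ∑ i ∈ A v, ξ i with hD
  have hx0 : ∀ u, 0 ≤ x u := by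
    intro u
    simp only [hx]
    split_ifs
    · simpa using userExcess_nonneg _ _ _ _ _
    · exact sub_nonneg.2 (userExcess_insert_mono hvV hv hτ u)
  have hwi : ∀ i, wInit ⟨insert v V, A⟩ dmax bmin i = wInit ⟨V, A⟩ dmax bmin i
      + if i ∈ A v then 1 / d else 0 := wInit_insert hvV hv
  have hnot : ∀ i, i ∉ A v → wTrunc ⟨insert v V, A⟩ τ dmax bmin i = wTrunc ⟨V, A⟩ τ dmax bmin i :=
    fun i hi => by simp only [wTrunc, hwi, hi, if_false, add_zero]
  have hξ0 : ∀ i ∈ A v, 0 ≤ ξ i := by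
    intro i hi
    have h0 : 0 ≤ 1 / d := by positivity
    simp only [hξ, wTrunc, hwi, hi, if_true]
    have : min (wInit ⟨V, A⟩ dmax bmin i + 1 / d) τ ≤ min (wInit ⟨V, A⟩ dmax bmin i) τ + 1 / d := by
      rw [← min_add_add_right]
      exact min_le_min le_rfl (by linarith)
    linarith
  have hξd : ∀ i ∈ A v, ξ i ≤ 1 / d := by
    intro i hi
    have h0 : 0 ≤ 1 / d := by positivity
    simp only [hξ, wTrunc, hwi, hi, if_true, sub_le_self_iff, sub_nonneg]
    exact min_le_min (by linarith) le_rfl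
  have hD0 : 0 ≤ D := Finset.sum_nonneg hξ0
  have hD1 : D ≤ 1 := by
    refine (Finset.sum_le_sum hξd).trans ?_
    rw [Finset.sum_const, nsmul_eq_mul, ← hd_def, mul_one_div_cancel hd0.ne']
  -- Conservation: the total excess is the truncated mass, whose increase is the initial weight
  -- added by `v` minus the growth of the truncated weights.
  have hxD : ∑ u ∈ adaptiveUsers ⟨insert v V, A⟩ dmax bmin, x u = D := by
    have hva : v ∉ adaptiveUsers ⟨V, A⟩ dmax bmin := fun h => hvV (adaptiveUsers_subset _ _ _ h)
    have hVW : Dataset.union ⟨V, A⟩ ⊆ W :=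
      Finset.biUnion_subset_biUnion_of_subset_left _ (Finset.subset_insert _ _)
    have e1 : ∑ u ∈ adaptiveUsers ⟨insert v V, A⟩ dmax bmin,
        (if u = v then 0 else userExcess ⟨V, A⟩ τ dmax bmin u)
        = ∑ u ∈ adaptiveUsers ⟨V, A⟩ dmax bmin, userExcess ⟨V, A⟩ τ dmax bmin u := by
      rw [adaptiveUsers_insert_of_isAdaptive hv, Finset.sum_insert hva, if_pos rfl, zero_add]
      refine Finset.sum_congr rfl fun u hu => if_neg ?_
      rintro rfl
      exact hva hu
    simp only [hx]
    rw [Finset.sum_sub_distrib, e1, sum_userExcess _ hτ _ _ (Finset.Subset.refl _),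
      sum_userExcess _ hτ _ _ hVW, ← Finset.sum_sub_distrib, hD,
      ← Finset.sum_subset hAW (fun i _ hi => ?_)]
    · refine Finset.sum_congr rfl fun i hi => ?_
      simp only [hξ, hwi, hi, if_true]
      ring
    · simp only [hwi, hnot i hi, hi, if_false]
      ring
  set q := discount dmax bmin * D / √dmax with hq
  have hα := discount_nonneg hd hb0
  have hsm : 1 ≤ √dmax := Real.one_le_sqrt.2 hd.le
  have hq0 : 0 ≤ q := by positivity
  have hq1 : q ≤ 1 := by
    have hα1 : discount dmax bmin ≤ 1 := by
      have : 0 ≤ 1 / (2 * √dmax) := by positivity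
      rw [discount]
      linarith
    rw [hq, div_le_one (by linarith)]
    nlinarith
  have hpt : ∀ i, mad ⟨insert v V, A⟩ τ dmax b bmin bmax i - mad ⟨V, A⟩ τ dmax b bmin bmax i
      = (if i ∈ A v then userWeights (A v) b bmin bmax i - ξ i else 0)
        + ∑ u ∈ adaptiveUsers ⟨insert v V, A⟩ dmax bmin,
          if i ∈ A u then discount dmax bmin * x u / dmax else 0 := by
    intro i
    rw [mad_insert_of_isAdaptive hvV hv, add_sub_cancel_left, wReroute_insert_sub hvV hv]
    congr 1
    split_ifs with hi
    · simp only [hξ]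
      ring
    · rw [hnot i hi]
      ring
  simp_rw [hpt]
  refine sum_add_sq_le_one hq0 hq1 ?_ ?_
  · simp_rw [ite_pow, zero_pow two_ne_zero]
    rw [Finset.sum_ite_mem, Finset.inter_eq_right.2 hAW]
    exact (sum_sub_sq_le hw.lower hw.sum_sq hξ0 hξd).trans
      (one_sub_mul_le_sq hd0 (hv.one_le hbpos) hbpos hv.2 hD0)
  · refine (sum_sq_sum_ite_le (m := dmax) (fun u _ => ?_) (fun u hu => ?_)).trans (le_of_eq ?_)
    · have := hx0 u
      positivity
    · exact (mem_adaptiveUsers.1 hu).2.2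
    · rw [← Finset.sum_div, ← Finset.mul_sum, hxD, hq, div_pow, div_pow,
        Real.sq_sqrt (by linarith)]
      field_simp

/-- Items that only the user `v` owns get weight at most `bmax / √t` if there are `t` of them. -/
lemma mad_insert_le (hvV : v ∉ V) {τ bmax : ℝ} (b : ι → ℝ) (hτ : 1 ≤ τ)
    (hd : 1 < dmax) (hb0 : 1 / 2 ≤ bmin) (hb1 : bmin ≤ 1) (hb2 : 1 ≤ bmax) {i : ι}
    (hi : i ∈ A v \ Dataset.union ⟨V, A⟩) :
    mad ⟨insert v V, A⟩ τ dmax b bmin bmax i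
      ≤ bmax / √((A v \ Dataset.union ⟨V, A⟩).card : ℝ) := by
  have hbpos : 0 < bmin := by linarith
  have hw := isBoundedWeight_userWeights (A v) b hbpos hb1 hb2
  set N := A v \ Dataset.union ⟨V, A⟩ with hN
  have hnew : ∀ j ∈ N, ∀ V' : Finset υ, V' ⊆ V → (V'.filter fun u => j ∈ A u) = ∅ := by
    intro j hj V' hV'
    refine Finset.filter_eq_empty_iff.2 fun u hu hju => ?_
    exact (Finset.mem_sdiff.1 hj).2 (mem_union.2 ⟨u, hV' hu, hju⟩)
  have hasub : adaptiveUsers ⟨V, A⟩ dmax bmin ⊆ V := adaptiveUsers_subset _ _ _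
  have hw0 : ∀ j ∈ N, wInit ⟨V, A⟩ dmax bmin j = 0 := fun j hj => by
    simp only [wInit, hnew j hj _ hasub, Finset.sum_empty]
  have ht0 : wTrunc ⟨V, A⟩ τ dmax bmin i = 0 := by
    rw [wTrunc, hw0 i hi, min_eq_left (by linarith)]
  have hr0 : wReroute ⟨V, A⟩ τ dmax bmin i = 0 := by
    simp only [wReroute, hnew i hi _ hasub, Finset.sum_empty]
  have hm0 : mad ⟨V, A⟩ τ dmax b bmin bmax i = 0 := by
    simp only [mad, ht0, hr0, hnew i hi _ hasub, hnew i hi _ Finset.sdiff_subset,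
      Finset.sum_empty, add_zero]
  have hiA : i ∈ A v := (Finset.mem_sdiff.1 hi).1
  have hNpos : 0 < N.card := Finset.card_pos.2 ⟨i, hi⟩
  have hNA : N.card ≤ (A v).card := Finset.card_le_card Finset.sdiff_subset
  have hsN : 0 < √(N.card : ℝ) := Real.sqrt_pos.2 (by exact_mod_cast hNpos)
  have hsNA : √(N.card : ℝ) ≤ √((A v).card : ℝ) := Real.sqrt_le_sqrt (by exact_mod_cast hNA)
  by_cases hv : IsAdaptive (A v) dmax bmin
  swap
  · rw [mad_insert_of_not hvV hv, hm0, zero_add, if_pos hiA]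
    exact (hw.upper i hiA).trans (div_le_div_of_nonneg_left (by linarith) hsN hsNA)
  have hd0 := hv.card_pos hbpos
  have hd1 : 1 / ((A v).card : ℝ) ≤ 1 := by
    rw [div_le_one hd0]
    exact_mod_cast hNpos.trans_le hNA
  have hwi : ∀ j ∈ N, wInit ⟨insert v V, A⟩ dmax bmin j = 1 / ((A v).card : ℝ) := fun j hj => by
    rw [wInit_insert hvV hv, hw0 j hj, zero_add, if_pos (Finset.mem_sdiff.1 hj).1]
  have ht1 : wTrunc ⟨insert v V, A⟩ τ dmax bmin i = 1 / ((A v).card : ℝ) := by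
    rw [wTrunc, hwi i hi, min_eq_left (hd1.trans hτ)]
  -- Since `1/d ≤ 1 ≤ τ`, new items are never truncated, so only the `d - t` items of `v` that are
  -- not new can return excess.
  have hex : ∀ j ∈ N, excessRatio ⟨insert v V, A⟩ τ dmax bmin j = 0 := fun j hj => by
    rw [excessRatio, hwi j hj]
    refine max_eq_left (div_nonpos_of_nonpos_of_nonneg ?_ (by positivity))
    linarith
  have hre : wReroute ⟨insert v V, A⟩ τ dmax bmin i
      = discount dmax bmin * userExcess ⟨insert v V, A⟩ τ dmax bmin v / dmax := by
    have hva : v ∉ adaptiveUsers ⟨V, A⟩ dmax bmin := fun h => hvV (hasub h)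
    simp only [wReroute, adaptiveUsers_insert_of_isAdaptive hv]
    rw [Finset.filter_insert, if_pos hiA, hnew i hi _ hasub]
    simp
  have hue : userExcess ⟨insert v V, A⟩ τ dmax bmin v
      ≤ (((A v).card : ℝ) - N.card) / (A v).card := by
    simp only [userExcess, deg]
    rw [← Finset.sum_sdiff (Finset.sdiff_subset : N ⊆ A v), Finset.sum_eq_zero (s := N) hex,
      add_zero, one_div_mul_eq_div]
    refine div_le_div_of_nonneg_right ?_ hd0.le
    calc ∑ j ∈ A v \ N, excessRatio ⟨insert v V, A⟩ τ dmax bmin j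
        ≤ ∑ j ∈ A v \ N, (1 : ℝ) :=
          Finset.sum_le_sum fun j _ => excessRatio_le_one _ (by linarith) _ _ _
      _ = ((A v).card : ℝ) - N.card := by
          rw [Finset.sum_const, nsmul_eq_mul, mul_one,
            Finset.cast_card_sdiff Finset.sdiff_subset]
  rw [mad_insert_of_isAdaptive hvV hv, hm0, ht0, hr0, ht1, if_pos hiA, hre]
  have h1 := hw.upper i hiA
  have h2 := inv_sqrt_add_discount_le (bmin := bmin) hNpos hNA hb1 hv.2
  have h3 : discount dmax bmin * userExcess ⟨insert v V, A⟩ τ dmax bmin v / dmax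
      ≤ discount dmax bmin * ((((A v).card : ℝ) - N.card) / (A v).card) / dmax := by
    have := discount_nonneg hd hb0
    gcongr
  -- Writing `bmax = 1 + (bmax - 1)`, the unit part absorbs the rerouted weight and the rest only
  -- needs `t ≤ d`.
  have h4 : (bmax - 1) * (1 / √((A v).card : ℝ)) ≤ (bmax - 1) * (1 / √(N.card : ℝ)) :=
    mul_le_mul_of_nonneg_left (one_div_le_one_div_of_le hsN hsNA) (by linarith)
  rw [div_eq_mul_one_div bmax] at h1 ⊢
  linarith

end Insert

end Sensitivity

/-! ### Adding a user -/

section AddUser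

variable {υ ι : Type*} [DecidableEq υ]

/-- `S'` is `S` together with the new user `v` and its item set. -/
structure Dataset.AddsUserWith (S S' : Dataset υ ι) (v : υ) : Prop where
  notMem : v ∉ S.users
  users_eq : S'.users = insert v S.users
  items_eq : ∀ u ∈ S.users, S'.items u = S.items u

namespace Dataset.AddsUserWith

variable {S S' : Dataset υ ι} {v : υ}

variable [DecidableEq ι]

lemma union_mk (h : S.AddsUserWith S' v) : Dataset.union ⟨S.users, S'.items⟩ = S.union :=
  Finset.biUnion_congr rfl h.items_eq

lemma union_subset (h : S.AddsUserWith S' v) : S.union ⊆ S'.union := by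
  intro i hi
  obtain ⟨u, hu, hiu⟩ := mem_union.1 hi
  exact mem_union.2 ⟨u, h.users_eq ▸ Finset.mem_insert_of_mem hu, (h.items_eq u hu).symm ▸ hiu⟩

lemma union_sdiff (h : S.AddsUserWith S' v) : S'.union \ S.union = S'.items v \ S.union := by
  ext i
  simp only [Finset.mem_sdiff, mem_union, h.users_eq, Finset.mem_insert]
  constructor
  · rintro ⟨⟨u, rfl | hu, hiu⟩, hi⟩
    · exact ⟨hiu, hi⟩
    · exact absurd ⟨u, hu, h.items_eq u hu ▸ hiu⟩ hi
  · exact fun ⟨hiv, hi⟩ => ⟨⟨v, Or.inl rfl, hiv⟩, hi⟩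

end Dataset.AddsUserWith

variable [DecidableEq ι]

/-- Weights `w` on `U` and `w'` on `U' ⊇ U` which a noisy threshold can hardly distinguish: they
are at distance at most `1` on `U`, and there are few new items, of small weight. -/
structure IsSensitivityBounded (Δ₀ : ℕ) (h : ℕ → ℝ) (U U' : Finset ι) (w w' : ι → ℝ) : Prop where
  subset : U ⊆ U'
  sum_sq : ∑ i ∈ U, (w' i - w i) ^ 2 ≤ 1
  card_le : (U' \ U).card ≤ Δ₀
  new_le : ∀ i ∈ U' \ U, w' i ≤ h (U' \ U).card

lemma Dataset.AddsUserWith.isSensitivityBounded_mad {S S' : Dataset υ ι} {v : υ}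
    (h : S.AddsUserWith S' v) {Δ₀ : ℕ} (hcard : (S'.items v).card ≤ Δ₀) {b b' : ι → ℝ}
    (hb : ∀ i ∈ S.union, b' i = b i) {τ dmax bmin bmax : ℝ} (hτ : 1 ≤ τ)
    (hd : 1 < dmax) (hb0 : 1 / 2 ≤ bmin) (hb1 : bmin ≤ 1) (hb2 : 1 ≤ bmax) :
    IsSensitivityBounded Δ₀ (fun t => bmax / √(t : ℝ)) S.union S'.union
      (mad S τ dmax b bmin bmax) (mad S' τ dmax b' bmin bmax) := by
  obtain ⟨V', A⟩ := S'
  obtain rfl : V' = insert v S.users := h.users_eq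
  -- The old weights may be computed with `b'` as well, so both sides use one bias vector.
  have hmad : mad ⟨S.users, A⟩ τ dmax b' bmin bmax = mad S τ dmax b bmin bmax :=
    mad_congr (S := S) (T := ⟨S.users, A⟩) rfl h.items_eq hb τ dmax bmin bmax
  have hunion : Dataset.union ⟨S.users, A⟩ = S.union := h.union_mk
  refine ⟨h.union_subset, ?_, ?_, ?_⟩
  · have := sum_mad_insert_sub_sq_le (A := A) h.notMem b' (zero_le_one.trans hτ) hd hb0 hb1 hb2
    rw [hmad] at this
    refine le_trans ?_ this
    exact Finset.sum_le_sum_of_subset_of_nonneg h.union_subset fun _ _ _ => sq_nonneg _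
  · rw [h.union_sdiff]
    exact (Finset.card_le_card Finset.sdiff_subset).trans hcard
  · rw [h.union_sdiff, ← hunion]
    exact fun i hi => mad_insert_le h.notMem b' hτ hd hb0 hb1 hb2 hi

end AddUser

/-! ### One noisy round -/

section Round

lemma measurableSet_forall_add_lt {ι : Type*} (N : Finset ι) (w : ι → ℝ) (ρ : ℝ) :
    MeasurableSet {z : ι → ℝ | ∀ i ∈ N, w i + z i < ρ} := by
  have : {z : ι → ℝ | ∀ i ∈ N, w i + z i < ρ} = ⋂ i ∈ N, {z : ι → ℝ | w i + z i < ρ} := by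
    ext z; simp
  rw [this]
  exact Finset.measurableSet_biInter N fun i _ => measurableSet_lt (by fun_prop) measurable_const

variable {ι : Type*} [DecidableEq ι] {Δ₀ : ℕ} {h : ℕ → ℝ} {U U' : Finset ι} {w w' : ι → ℝ}

/-- The change of the weights of the old items. -/
def weightShift (U : Finset ι) (w w' : ι → ℝ) : ι → ℝ := fun i => if i ∈ U then w' i - w i else 0

lemma weightShift_of_mem {i : ι} (hi : i ∈ U) : weightShift U w w' i = w' i - w i := if_pos hi

lemma weightShift_of_notMem {i : ι} (hi : i ∉ U) : weightShift U w w' i = 0 := if_neg hi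

variable {σ ε δ : ℝ} {f f' : (ι → ℝ) → ℝ≥0∞} {K D : ℝ≥0∞}

/-- The `δ` splits into halves, one for the translated noise and one for a new item reaching the
threshold. The factors `K` and `D` leave room for a later round. -/
lemma IsSensitivityBounded.lintegral_le (hw : IsSensitivityBounded Δ₀ h U U' w w')
    (hσ : IsGaussianScale 1 ε (δ / 2) σ) (hδ0 : 0 < δ) (hδ1 : δ ≤ 1)
    (hf : Measurable f) (hf' : ∀ z, f' z ≤ 1)
    (hff' : ∀ z, (∀ i ∈ U' \ U, w' i + z i < threshold Δ₀ h σ δ) →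
      f' z ≤ K * f (z + weightShift U w w') + D) :
    ∫⁻ z, f' z ∂gaussianNoise ι σ ≤ ENNReal.ofReal (Real.exp ε) * K * ∫⁻ z, f z ∂gaussianNoise ι σ
      + (D + ENNReal.ofReal δ) := by
  have hδ : ENNReal.ofReal δ = ENNReal.ofReal (δ / 2) + ENNReal.ofReal (δ / 2) := by
    rw [← ENNReal.ofReal_add (by linarith) (by linarith), add_halves]
  rw [hδ]
  refine lintegral_le_of_gaussian_shift hσ U _ (fun i hi => weightShift_of_notMem hi) ?_ hf hf'
    (measurableSet_forall_add_lt _ _ _)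
    (gaussianNoise_exists_threshold_le hσ.1 hδ0 hδ1 _ hw.card_le w' hw.new_le) hff'
  rw [Finset.sum_congr rfl fun i hi => by rw [weightShift_of_mem hi]]
  exact hw.sum_sq

lemma IsSensitivityBounded.lintegral_le_symm (hw : IsSensitivityBounded Δ₀ h U U' w w')
    (hσ : IsGaussianScale 1 ε (δ / 2) σ) (hδ0 : 0 < δ) (hδ1 : δ ≤ 1)
    (hf' : Measurable f') (hf : ∀ z, f z ≤ 1)
    (hff' : ∀ z, (∀ i ∈ U' \ U, w' i + z i < threshold Δ₀ h σ δ) →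
      f (z + weightShift U w w') ≤ K * f' z + D) :
    ∫⁻ z, f z ∂gaussianNoise ι σ ≤ ENNReal.ofReal (Real.exp ε) * K * ∫⁻ z, f' z ∂gaussianNoise ι σ
      + (D + ENNReal.ofReal δ) := by
  have hδ : ENNReal.ofReal δ = ENNReal.ofReal (δ / 2) + ENNReal.ofReal (δ / 2) := by
    rw [← ENNReal.ofReal_add (by linarith) (by linarith), add_halves]
  rw [hδ]
  refine lintegral_le_of_gaussian_shift hσ U (-weightShift U w w')
    (fun i hi => by rw [Pi.neg_apply, weightShift_of_notMem hi, neg_zero]) ?_ hf' hf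
    (measurableSet_forall_add_lt _ _ _)
    (gaussianNoise_exists_threshold_le hσ.1 hδ0 hδ1 _ hw.card_le w' hw.new_le) fun z hz => ?_
  · rw [Finset.sum_congr rfl fun i hi => by rw [Pi.neg_apply, neg_sq, weightShift_of_mem hi]]
    exact hw.sum_sq
  · have := hff' (z + -weightShift U w w') fun i hi => by
      rw [Pi.add_apply, Pi.neg_apply, weightShift_of_notMem (Finset.mem_sdiff.1 hi).2, neg_zero,
        add_zero]
      exact hz i hi
    rwa [neg_add_cancel_right] at this

/-- The items of `U` whose noisy weight reaches the threshold. -/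
noncomputable def selected (U : Finset ι) (w : ι → ℝ) (ρ : ℝ) (z : ι → ℝ) : Finset ι :=
  U.filter fun i => ρ ≤ w i + z i

omit [DecidableEq ι] in
lemma mem_selected {i : ι} {ρ : ℝ} {z : ι → ℝ} :
    i ∈ selected U w ρ z ↔ i ∈ U ∧ ρ ≤ w i + z i := Finset.mem_filter

lemma selected_eq_of_forall_lt (hU : U ⊆ U') {ρ : ℝ} {z : ι → ℝ}
    (hz : ∀ i ∈ U' \ U, w' i + z i < ρ) :
    selected U' w' ρ z = selected U w ρ (z + weightShift U w w') := by
  ext i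
  rw [mem_selected, mem_selected]
  by_cases hi : i ∈ U
  · rw [Pi.add_apply, weightShift_of_mem hi]
    have : w i + (z i + (w' i - w i)) = w' i + z i := by ring
    simp [hi, hU hi, this]
  · simp only [hi, false_and, iff_false, not_and, not_le]
    exact fun hi' => hz i (Finset.mem_sdiff.2 ⟨hi', hi⟩)

lemma measurableSet_selected_mem (U : Finset ι) (w : ι → ℝ) (ρ : ℝ) (O : Set (Finset ι)) :
    MeasurableSet {z | selected U w ρ z ∈ O} := by
  refine measurableSet_of_finset_partition (U := U) (t := selected U w ρ)
    (fun z => Finset.filter_subset _ _) (fun i hi => ?_) (p := fun B _ => B ∈ O)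
    fun B _ => .const _
  simp only [mem_selected, hi, true_and]
  exact measurableSet_le measurable_const (by fun_prop)

lemma IsSensitivityBounded.selected_le (hw : IsSensitivityBounded Δ₀ h U U' w w')
    (hσ : IsGaussianScale 1 ε (δ / 2) σ) (hδ0 : 0 < δ) (hδ1 : δ ≤ 1) (O : Set (Finset ι)) :
    gaussianNoise ι σ {z | selected U' w' (threshold Δ₀ h σ δ) z ∈ O}
      ≤ ENNReal.ofReal (Real.exp ε)
        * gaussianNoise ι σ {z | selected U w (threshold Δ₀ h σ δ) z ∈ O} + ENNReal.ofReal δ := by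
  have hm := measurableSet_selected_mem U w (threshold Δ₀ h σ δ) O
  have hm' := measurableSet_selected_mem U' w' (threshold Δ₀ h σ δ) O
  have := hw.lintegral_le hσ hδ0 hδ1 (K := 1) (D := 0) (measurable_one.indicator hm)
    (f' := Set.indicator {z | selected U' w' (threshold Δ₀ h σ δ) z ∈ O} 1)
    (fun z => Set.indicator_le_self' (fun _ _ => zero_le_one) z) fun z hz => by
      change O.indicator 1 (selected U' w' _ z) ≤ 1 * O.indicator 1 (selected U w _ _) + 0
      rw [selected_eq_of_forall_lt hw.subset hz, one_mul, add_zero]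
  rwa [lintegral_indicator_one hm, lintegral_indicator_one hm', mul_one, zero_add] at this

lemma IsSensitivityBounded.selected_le_symm (hw : IsSensitivityBounded Δ₀ h U U' w w')
    (hσ : IsGaussianScale 1 ε (δ / 2) σ) (hδ0 : 0 < δ) (hδ1 : δ ≤ 1) (O : Set (Finset ι)) :
    gaussianNoise ι σ {z | selected U w (threshold Δ₀ h σ δ) z ∈ O}
      ≤ ENNReal.ofReal (Real.exp ε)
        * gaussianNoise ι σ {z | selected U' w' (threshold Δ₀ h σ δ) z ∈ O}
        + ENNReal.ofReal δ := by
  have hm := measurableSet_selected_mem U w (threshold Δ₀ h σ δ) O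
  have hm' := measurableSet_selected_mem U' w' (threshold Δ₀ h σ δ) O
  have := hw.lintegral_le_symm hσ hδ0 hδ1 (K := 1) (D := 0) (measurable_one.indicator hm')
    (f := Set.indicator {z | selected U w (threshold Δ₀ h σ δ) z ∈ O} 1)
    (fun z => Set.indicator_le_self' (fun _ _ => zero_le_one) z) fun z hz => by
      change O.indicator 1 (selected U w _ _) ≤ 1 * O.indicator 1 (selected U' w' _ z) + 0
      rw [selected_eq_of_forall_lt hw.subset hz, one_mul, add_zero]
  rwa [lintegral_indicator_one hm, lintegral_indicator_one hm', mul_one, zero_add] at this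

end Round

/-! ### Measurability of `MAD2R` -/

section OutputMeasurable

variable {υ ι : Type*} [DecidableEq ι]

/-- The dataset with the items of `B` removed. -/
def Dataset.erase (S : Dataset υ ι) (B : Finset ι) : Dataset υ ι where
  users := S.users
  items := fun u => S.items u \ B

lemma Dataset.erase_union_subset (S : Dataset υ ι) (B : Finset ι) :
    (S.erase B).union ⊆ S.union :=
  Finset.biUnion_mono fun _ _ => Finset.sdiff_subset

variable [DecidableEq υ]

lemma measurable_mad (S : Dataset υ ι) (τ dmax bmin bmax : ℝ) (i : ι) :
    Measurable fun b : ι → ℝ => mad S τ dmax b bmin bmax i := by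
  have h : ∀ u, Measurable fun b : ι → ℝ => userWeights (S.items u) b bmin bmax i := fun u =>
    (measurable_pi_apply i).comp (measurable_userWeights (S.items u) bmin bmax)
  unfold mad
  exact (measurable_const.add (Finset.measurable_sum _ fun u _ => (h u).sub measurable_const)).add
    (Finset.measurable_sum _ fun u _ => h u)

namespace Params

variable (P : Params) (S : Dataset υ ι)

/-- The weights of round 1. -/
noncomputable def weights₁ : ι → ℝ :=
  mad S (P.ρ₁ + P.β * P.σ₁) P.dmax (fun _ => 1) 1 1

/-- The weights of round 2, given the noisy weights `w` of round 1. -/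
noncomputable def weights₂ (w : ι → ℝ) : ι → ℝ :=
  mad S (P.ρ₂ + P.β * P.σ₂) P.dmax (P.bias w) P.bmin P.bmax

lemma found₁_eq_selected (z : ι → ℝ) : P.found₁ S z = selected S.union (P.weights₁ S) P.ρ₁ z := rfl

lemma found₂_eq_selected (z₁ z₂ : ι → ℝ) : P.found₂ S z₁ z₂
    = selected (P.remaining S z₁).union (P.weights₂ (P.remaining S z₁) (P.noisy₁ S z₁)) P.ρ₂ z₂ :=
  rfl

lemma mem_lowItems {z : ι → ℝ} {i : ι} :
    i ∈ P.lowItems S z ↔ i ∈ S.union ∧ P.noisy₁ S z i + P.Cub * P.σ₁ < P.ρ₂ := Finset.mem_filter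

omit [DecidableEq ι] in
lemma measurable_bias : Measurable fun w : ι → ℝ => P.bias w := by
  refine measurable_pi_iff.2 fun i => ?_
  have h : Measurable fun w : ι → ℝ => P.lowerBound w i := by
    unfold lowerBound
    fun_prop
  exact Measurable.ite (h (measurableSet_singleton 0)) measurable_const
    (measurable_const.min (measurable_const.div h))

/-- The set removed before round 2 takes finitely many values. Freezing it makes the dataset of
round 2 deterministic, so that the noise enters only through the biases and the thresholds. -/
lemma measurableSet_output (O : Set (Finset ι)) :
    MeasurableSet {z | P.output S z ∈ O} := by
  have hnoisy : ∀ i, Measurable fun z : (ι → ℝ) × (ι → ℝ) => P.noisy₁ S z.1 i := fun i => by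
    unfold noisy₁
    fun_prop
  have hfound : ∀ i, MeasurableSet {z : (ι → ℝ) × (ι → ℝ) | i ∈ P.found₁ S z.1} := fun i => by
    simp only [found₁, Finset.mem_filter]
    exact (MeasurableSet.const _).inter (measurableSet_le measurable_const (hnoisy i))
  have hlow : ∀ i, MeasurableSet {z : (ι → ℝ) × (ι → ℝ) | i ∈ P.lowItems S z.1} := fun i => by
    simp only [mem_lowItems]
    exact (MeasurableSet.const _).inter
      (measurableSet_lt ((hnoisy i).add_const _) measurable_const)
  refine measurableSet_of_finset_partition (U := S.union)
    (t := fun z : (ι → ℝ) × (ι → ℝ) => P.found₁ S z.1 ∪ P.lowItems S z.1)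
    (p := fun B z => P.found₁ S z.1 ∪ selected (S.erase B).union
      (P.weights₂ (S.erase B) (P.noisy₁ S z.1)) P.ρ₂ z.2 ∈ O)
    (fun z => Finset.union_subset (Finset.filter_subset _ _) (Finset.filter_subset _ _))
    (fun i _ => ?_) fun B _ => ?_
  · simp only [Finset.mem_union]
    exact (hfound i).union (hlow i)
  · refine measurableSet_of_finset_partition (U := S.union)
      (t := fun z : (ι → ℝ) × (ι → ℝ) => P.found₁ S z.1 ∪ selected (S.erase B).union
        (P.weights₂ (S.erase B) (P.noisy₁ S z.1)) P.ρ₂ z.2) (p := fun C _ => C ∈ O)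
      (fun z => Finset.union_subset (Finset.filter_subset _ _)
        ((Finset.filter_subset _ _).trans (S.erase_union_subset B)))
      (fun i _ => ?_) fun C _ => .const _
    simp only [Finset.mem_union, mem_selected]
    have hw : Measurable fun z : (ι → ℝ) × (ι → ℝ) =>
        P.weights₂ (S.erase B) (P.noisy₁ S z.1) i + z.2 i :=
      ((measurable_mad _ _ _ _ _ i).comp
        (P.measurable_bias.comp (measurable_pi_iff.2 hnoisy))).add (by fun_prop)
    have hsel : MeasurableSet {z : (ι → ℝ) × (ι → ℝ) |
        P.ρ₂ ≤ P.weights₂ (S.erase B) (P.noisy₁ S z.1) i + z.2 i} :=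
      measurableSet_le measurable_const hw
    exact (hfound i).union ((MeasurableSet.const _).inter hsel)

end Params

end OutputMeasurable

/-! ### Privacy of the two rounds on capped datasets -/

section Capped

variable {υ ι : Type*} [DecidableEq υ] [DecidableEq ι]

namespace Params

variable {P : Params}

lemma Valid.one_le_threshold₁ (hP : P.Valid) : 1 ≤ P.ρ₁ + P.β * P.σ₁ := by
  have h := le_threshold_one hP.one_le_Δ₀ (fun t => 1 / √(t : ℝ)) hP.scale₁.1.le hP.δ₁_le_one
  have := mul_nonneg hP.β_nonneg hP.scale₁.1.le
  simp only [Nat.cast_one, Real.sqrt_one, div_one] at h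
  rw [ρ₁]
  linarith

lemma Valid.one_le_threshold₂ (hP : P.Valid) : 1 ≤ P.ρ₂ + P.β * P.σ₂ := by
  have h := le_threshold_one hP.one_le_Δ₀ (fun t => P.bmax / √(t : ℝ)) hP.scale₂.1.le hP.δ₂_le_one
  have := mul_nonneg hP.β_nonneg hP.scale₂.1.le
  have := hP.one_le_bmax
  simp only [Nat.cast_one, Real.sqrt_one, div_one] at h
  rw [ρ₂]
  linarith

variable {S S' : Dataset υ ι} {v : υ}

lemma Valid.isSensitivityBounded₁ (hP : P.Valid) (h : S.AddsUserWith S' v)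
    (hcard : (S'.items v).card ≤ P.Δ₀) :
    IsSensitivityBounded P.Δ₀ (fun t => 1 / √(t : ℝ)) S.union S'.union (P.weights₁ S)
      (P.weights₁ S') :=
  h.isSensitivityBounded_mad hcard (fun _ _ => rfl) hP.one_le_threshold₁ hP.one_lt_dmax
    (by norm_num) le_rfl le_rfl

lemma Valid.isSensitivityBounded₂ (hP : P.Valid) (h : S.AddsUserWith S' v)
    (hcard : (S'.items v).card ≤ P.Δ₀) {w w' : ι → ℝ} (hw : ∀ i ∈ S.union, w' i = w i) :
    IsSensitivityBounded P.Δ₀ (fun t => P.bmax / √(t : ℝ)) S.union S'.union (P.weights₂ S w)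
      (P.weights₂ S' w') :=
  h.isSensitivityBounded_mad hcard
    (fun i hi => by
      have : P.lowerBound w' i = P.lowerBound w i := by rw [lowerBound, hw i hi, lowerBound]
      simp only [bias, this])
    hP.one_le_threshold₂ hP.one_lt_dmax hP.half_le_bmin hP.bmin_le_one hP.one_le_bmax

/-- If no new item is found in round 1, the datasets of round 2 are neighbouring. -/
lemma addsUserWith_remaining (h : S.AddsUserWith S' v) {z z' : ι → ℝ}
    (hfound : P.found₁ S' z' = P.found₁ S z)
    (hnoisy : ∀ i ∈ S.union, P.noisy₁ S' z' i = P.noisy₁ S z i) :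
    (P.remaining S z).AddsUserWith (P.remaining S' z') v := by
  refine ⟨h.notMem, h.users_eq, fun u hu => ?_⟩
  simp only [remaining, hfound, h.items_eq u hu]
  ext i
  simp only [Finset.mem_sdiff, Finset.mem_union, mem_lowItems]
  -- The low sets of the two runs may differ on new items, but old users own none of these.
  refine and_congr_right fun hi => ?_
  have hiU : i ∈ S.union := mem_union.2 ⟨u, hu, hi⟩
  rw [hnoisy i hiU]
  simp [hiU, h.union_subset hiU]

/-- The two directions of the privacy of round 2, given noise of round 1 for which no new item is
found. -/
lemma Valid.output_le (hP : P.Valid) (h : S.AddsUserWith S' v) (hcard : (S'.items v).card ≤ P.Δ₀)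
    (O : Set (Finset ι)) {z : ι → ℝ}
    (hz : ∀ i ∈ S'.union \ S.union, P.weights₁ S' i + z i < P.ρ₁) :
    gaussianNoise ι P.σ₂ {z₂ | P.output S' (z, z₂) ∈ O}
        ≤ ENNReal.ofReal (Real.exp P.ε₂) * gaussianNoise ι P.σ₂
          {z₂ | P.output S (z + weightShift S.union (P.weights₁ S) (P.weights₁ S'), z₂) ∈ O}
          + ENNReal.ofReal P.δ₂ ∧
      gaussianNoise ι P.σ₂
          {z₂ | P.output S (z + weightShift S.union (P.weights₁ S) (P.weights₁ S'), z₂) ∈ O}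
        ≤ ENNReal.ofReal (Real.exp P.ε₂) * gaussianNoise ι P.σ₂ {z₂ | P.output S' (z, z₂) ∈ O}
          + ENNReal.ofReal P.δ₂ := by
  set z' := z + weightShift S.union (P.weights₁ S) (P.weights₁ S') with hz'
  have hfound : P.found₁ S' z = P.found₁ S z' := by
    rw [found₁_eq_selected, found₁_eq_selected]
    exact selected_eq_of_forall_lt h.union_subset hz
  have hnoisy : ∀ i ∈ S.union, P.noisy₁ S' z i = P.noisy₁ S z' i := by
    intro i hi
    change P.weights₁ S' i + z i = P.weights₁ S i + z' i
    rw [hz', Pi.add_apply, weightShift_of_mem hi]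
    ring
  have hT := addsUserWith_remaining h hfound hnoisy
  have hcardT : ((P.remaining S' z).items v).card ≤ P.Δ₀ :=
    (Finset.card_le_card Finset.sdiff_subset).trans hcard
  have hb := hP.isSensitivityBounded₂ hT hcardT (w := P.noisy₁ S z') (w' := P.noisy₁ S' z)
    fun i hi => hnoisy i (S.erase_union_subset _ hi)
  simp only [output, hfound, found₂_eq_selected]
  -- Round 1 contributes the same fixed set in both runs, so the output event is an event about
  -- round 2 alone.
  exact ⟨hb.selected_le hP.scale₂ hP.δ₂_pos hP.δ₂_le_one {C | P.found₁ S z' ∪ C ∈ O},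
    hb.selected_le_symm hP.scale₂ hP.δ₂_pos hP.δ₂_le_one {C | P.found₁ S z' ∪ C ∈ O}⟩

/-- Condition on the noise of round 1: the privacy of round 2 supplies `K = e^ε₂` and `D = δ₂` in
the one-round estimate for round 1. -/
lemma Valid.prod_output_le (hP : P.Valid) (h : S.AddsUserWith S' v)
    (hcard : (S'.items v).card ≤ P.Δ₀) (O : Set (Finset ι)) :
    ((gaussianNoise ι P.σ₁).prod (gaussianNoise ι P.σ₂)) {z | P.output S' z ∈ O}
        ≤ ENNReal.ofReal (Real.exp (P.ε₁ + P.ε₂))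
          * ((gaussianNoise ι P.σ₁).prod (gaussianNoise ι P.σ₂)) {z | P.output S z ∈ O}
          + ENNReal.ofReal (P.δ₁ + P.δ₂) ∧
      ((gaussianNoise ι P.σ₁).prod (gaussianNoise ι P.σ₂)) {z | P.output S z ∈ O}
        ≤ ENNReal.ofReal (Real.exp (P.ε₁ + P.ε₂))
          * ((gaussianNoise ι P.σ₁).prod (gaussianNoise ι P.σ₂)) {z | P.output S' z ∈ O}
          + ENNReal.ofReal (P.δ₁ + P.δ₂) := by
  have hm := P.measurableSet_output S O
  have hm' := P.measurableSet_output S' O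
  have hb := hP.isSensitivityBounded₁ h hcard
  rw [Measure.prod_apply hm, Measure.prod_apply hm', Real.exp_add,
    ENNReal.ofReal_mul (Real.exp_nonneg _), add_comm P.δ₁,
    ENNReal.ofReal_add hP.δ₂_pos.le hP.δ₁_pos.le]
  exact ⟨hb.lintegral_le hP.scale₁ hP.δ₁_pos hP.δ₁_le_one (measurable_measure_prodMk_left hm)
      (fun z => prob_le_one) fun z hz => (hP.output_le h hcard O hz).1,
    hb.lintegral_le_symm hP.scale₁ hP.δ₁_pos hP.δ₁_le_one (measurable_measure_prodMk_left hm')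
      (fun z => prob_le_one) fun z hz => (hP.output_le h hcard O hz).2⟩

end Params

end Capped

/-! ### Averaging over the random subsets -/

section Averaging

variable {υ ι : Type*} [DecidableEq υ] {S S' : Dataset υ ι} {v : υ}

lemma cappings_card_pos (Δ₀ : ℕ) (S : Dataset υ ι) : 0 < (cappings Δ₀ S).card := by
  rw [cappings, Finset.card_pi]
  refine Finset.prod_pos fun u _ => ?_
  rw [Finset.card_powersetCard]
  exact Nat.choose_pos (min_le_right _ _)

/-- The coupling of the cappings: old users keep the same subsets, and `v` receives an arbitrary
one. -/
lemma capped_addsUserWith {V : Finset υ} {A A' : υ → Finset ι} (hv : v ∉ V)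
    (c : (u : υ) → u ∈ V → Finset ι) (B : Finset ι) :
    (Dataset.capped ⟨V, A⟩ c).AddsUserWith
      (Dataset.capped ⟨insert v V, A'⟩ (Finset.Pi.cons V v B c)) v := by
  refine ⟨hv, rfl, fun u hu => ?_⟩
  have huV : u ∈ V := hu
  have huv : v ≠ u := fun h => hv (h ▸ huV)
  simp only [Dataset.capped, huV, Finset.mem_insert_of_mem huV, dif_pos]
  exact Finset.Pi.cons_ne huv

/-- A sum over the cappings of a dataset with an additional user. -/
lemma sum_cappings_insert {M : Type*} [AddCommMonoid M] {V : Finset υ} {A A' : υ → Finset ι}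
    (hv : v ∉ V) (hA : ∀ u ∈ V, A' u = A u) (Δ₀ : ℕ)
    (F : ((u : υ) → u ∈ insert v V → Finset ι) → M) :
    ∑ c ∈ cappings Δ₀ ⟨insert v V, A'⟩, F c
      = ∑ c ∈ cappings Δ₀ ⟨V, A⟩, ∑ B ∈ (A' v).powersetCard (min Δ₀ (A' v).card),
          F (Finset.Pi.cons V v B c) := by
  classical
  rw [Finset.sum_comm, cappings, cappings, Finset.pi_insert hv, Finset.sum_biUnion]
  · refine Finset.sum_congr rfl fun B _ => ?_
    rw [Finset.sum_image fun _ _ _ _ h => Finset.Pi.cons_injective hv h]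
    refine Finset.sum_congr ?_ fun _ _ => rfl
    ext c
    simp only [Finset.mem_pi]
    exact forall₂_congr fun u hu => by rw [hA u hu]
  · intro B _ B' _ hBB'
    simp only [Function.onFun, Finset.disjoint_left, Finset.mem_image, not_exists, not_and]
    rintro _ ⟨c, _, rfl⟩ c' _ h
    have := congrFun (congrFun h v) (Finset.mem_insert_self v V)
    rw [Finset.Pi.cons_same, Finset.Pi.cons_same] at this
    exact hBB' this.symm

lemma mad2rProb_le_and_le [DecidableEq ι] {P : Params} (hP : P.Valid) (h : S.AddsUser S')
    (O : Set (Finset ι)) :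
    mad2rProb P S' O ≤ ENNReal.ofReal (Real.exp (P.ε₁ + P.ε₂)) * mad2rProb P S O
        + ENNReal.ofReal (P.δ₁ + P.δ₂) ∧
      mad2rProb P S O ≤ ENNReal.ofReal (Real.exp (P.ε₁ + P.ε₂)) * mad2rProb P S' O
        + ENNReal.ofReal (P.δ₁ + P.δ₂) := by
  obtain ⟨v, hv, hu, hi⟩ := h
  obtain ⟨V, A⟩ := S
  obtain ⟨V', A'⟩ := S'
  obtain rfl : V' = insert v V := hu
  have hv : v ∉ V := hv
  set K := ENNReal.ofReal (Real.exp (P.ε₁ + P.ε₂))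
  set D := ENNReal.ofReal (P.δ₁ + P.δ₂)
  set Q := (A' v).powersetCard (min P.Δ₀ (A' v).card) with hQ
  set C := cappings P.Δ₀ (⟨V, A⟩ : Dataset υ ι) with hC
  set f : ((u : υ) → u ∈ V → Finset ι) → ℝ≥0∞ := fun c =>
    ((gaussianNoise ι P.σ₁).prod (gaussianNoise ι P.σ₂))
      {z | P.output (Dataset.capped ⟨V, A⟩ c) z ∈ O} with hf
  set g : ((u : υ) → u ∈ insert v V → Finset ι) → ℝ≥0∞ := fun c =>
    ((gaussianNoise ι P.σ₁).prod (gaussianNoise ι P.σ₂))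
      {z | P.output (Dataset.capped ⟨insert v V, A'⟩ c) z ∈ O} with hg
  have hfg : ∀ c, ∀ B ∈ Q, g (Finset.Pi.cons V v B c) ≤ K * f c + D ∧
      f c ≤ K * g (Finset.Pi.cons V v B c) + D := by
    intro c B hB
    refine hP.prod_output_le (capped_addsUserWith hv c B) ?_ O
    simp only [Dataset.capped, Finset.mem_insert_self, dif_pos, Finset.Pi.cons_same]
    rw [(Finset.mem_powersetCard.1 hB).2]
    exact min_le_left _ _
  have hCpos : C.card ≠ 0 := (cappings_card_pos _ _).ne'
  have hQpos : Q.card ≠ 0 := by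
    rw [hQ, Finset.card_powersetCard]
    exact (Nat.choose_pos (min_le_right _ _)).ne'
  have hcard : (cappings P.Δ₀ (⟨insert v V, A'⟩ : Dataset υ ι)).card = C.card * Q.card := by
    rw [Finset.card_eq_sum_ones, sum_cappings_insert hv hi]
    simp [hC, hQ]
  have hn0 : ((C.card * Q.card : ℕ) : ℝ≥0∞) ≠ 0 := by
    exact_mod_cast mul_ne_zero hCpos hQpos
  have hntop : ((C.card * Q.card : ℕ) : ℝ≥0∞) ≠ ∞ := ENNReal.natCast_ne_top _
  have e' : mad2rProb P ⟨insert v V, A'⟩ O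
      = (∑ c ∈ C, ∑ B ∈ Q, g (Finset.Pi.cons V v B c)) / ((C.card * Q.card : ℕ) : ℝ≥0∞) := by
    rw [mad2rProb, hcard, sum_cappings_insert hv hi]
  -- The subset `B` of the absent user is averaged over as a dummy variable, which puts both
  -- probabilities over the same denominator and allows termwise comparison.
  have e : mad2rProb P ⟨V, A⟩ O
      = (∑ c ∈ C, ∑ B ∈ Q, f c) / ((C.card * Q.card : ℕ) : ℝ≥0∞) := by
    simp_rw [Finset.sum_const, nsmul_eq_mul]
    rw [← Finset.mul_sum, mul_comm C.card, Nat.cast_mul, ENNReal.mul_div_mul_left]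
    · rfl
    · exact_mod_cast hQpos
    · exact ENNReal.natCast_ne_top _
  have key : ∀ F G : ((u : υ) → u ∈ V → Finset ι) → Finset ι → ℝ≥0∞,
      (∀ c, ∀ B ∈ Q, G c B ≤ K * F c B + D) →
      (∑ c ∈ C, ∑ B ∈ Q, G c B) / ((C.card * Q.card : ℕ) : ℝ≥0∞)
        ≤ K * ((∑ c ∈ C, ∑ B ∈ Q, F c B) / ((C.card * Q.card : ℕ) : ℝ≥0∞)) + D := by
    intro F G hFG
    calc (∑ c ∈ C, ∑ B ∈ Q, G c B) / ((C.card * Q.card : ℕ) : ℝ≥0∞)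
        ≤ (∑ c ∈ C, ∑ B ∈ Q, (K * F c B + D)) / ((C.card * Q.card : ℕ) : ℝ≥0∞) := by
          gcongr with c _ B hB
          exact hFG c B hB
      _ = (K * (∑ c ∈ C, ∑ B ∈ Q, F c B) + D * ((C.card * Q.card : ℕ) : ℝ≥0∞))
            / ((C.card * Q.card : ℕ) : ℝ≥0∞) := by
          simp_rw [Finset.sum_add_distrib, ← Finset.mul_sum, Finset.sum_const, nsmul_eq_mul]
          push_cast
          ring_nf
      _ = K * ((∑ c ∈ C, ∑ B ∈ Q, F c B) / ((C.card * Q.card : ℕ) : ℝ≥0∞)) + D := by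
          rw [ENNReal.add_div, mul_div_assoc, ENNReal.mul_div_cancel_right hn0 hntop]
  rw [e, e']
  exact ⟨key (fun c _ => f c) (fun c B => g (Finset.Pi.cons V v B c)) fun c B hB => (hfg c B hB).1,
    key (fun c B => g (Finset.Pi.cons V v B c)) (fun c _ => f c) fun c B hB => (hfg c B hB).2⟩

end Averaging

end PartitionSelection

/-- For all valid parameters, `MAD2R` is `(ε₁ + ε₂, δ₁ + δ₂)`-differentially private. -/
theorem theorem5p1 {υ ι : Type*} [DecidableEq υ] [DecidableEq ι]
    (P : PartitionSelection.Params) (hP : P.Valid) :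
    PartitionSelection.IsDP
      (fun (S : PartitionSelection.Dataset υ ι) O => PartitionSelection.mad2rProb P S O)
      (P.ε₁ + P.ε₂) (P.δ₁ + P.δ₂) := by
  rintro S S' (h | h) O
  · exact (PartitionSelection.mad2rProb_le_and_le hP h O).2
  · exact (PartitionSelection.mad2rProb_le_and_le hP h O).1
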